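/- Let $\Omega\subset\mathbb R^n$ be a bounded open set of class $C^\infty$ and let $\Omega'$ be an open set with $\Omega'\subset\subset\Omega$, i.e. $\overline{\Omega'}$ is compact and contained in $\Omega$. Let $C^\infty(\overline\Omega)$ be the algebra of complex-valued functions that are smooth up to the boundary, with the seminorms $\mu_k(f)=\sup\{|D^\alpha f(x)|:|\alpha|\le k,\ x\in\overline\Omega\}$. A net $(u_\epsilon)_{\epsilon\in(0,1]}$ in $C^\infty(\overline\Omega)$ is moderate if for every $k$ there is $a\in\mathbb R$ with $\mu_k(u_\epsilon)=O(\epsilon^a)$ as $\epsilon\to0$, and null if it is moderate and this holds for every $k$ and every $a\in\mathbb R$. Let $\mathcal G(\overline\Omega)=\mathcal E_M(\overline\Omega)/\mathcal N(\overline\Omega)$ be the quotient of the algebra of moderate nets by the ideal of null nets, and let $\sigma:C^\infty(\overline\Omega)\to\mathcal G(\overline\Omega)$ send $f$ to the class of the constant net $u_\epsilon=f$. Let $\mathcal E'(\Omega')$ be the space of distributions on $\Omega$ with compact support contained in $\Omega'$, and let $$\mathcal F'(\Omega)=\mathcal E'(\Omega')+\bigcup_{0\le k\le\infty,\ 1\le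 p\le\infty}W^{k,p}(\Omega)\subset\mathcal D'(\Omega).$$ Let $E$ be a total extension operator extended to $\mathcal E'(\Omega')$, that is, a linear map from $\mathcal F'(\Omega)$ to the distributions on $\mathbb R^n$, with values in the tempered distributions, such that $E(u)|_\Omega=u$ for all $u\in\mathcal F'(\Omega)$; for every finite $k\ge0$ and every $1\le p\le\infty$ there is a constant $C$ with $\|Eu\|_{W^{k,p}(\mathbb R^n)}\le C\|u\|_{W^{k,p}(\Omega)}$ for all $u\in W^{k,p}(\Omega)$; and $E(u)$ is supported in $\Omega$ for all $u\in\mathcal E'(\Omega')$ (extension by zero). Let $\psi\in\mathcal S(\mathbb R^n)$ be equal to $1$ on a neighbourhood of $0$, let $\phi=\mathcal F^{-1}[\psi]$ and $\phi_\epsilon(x)=\epsilon^{-n}\phi(x/\epsilon)$, and let $$i:\mathcal F'(\Omega)\to\mathcal G(\overline\Omega),\qquad i(u)=(E(u)*\phi_\epsilon)|_{\overline\Omega}+\mathcal N(\overline\Omega).$$ Then $i|_{C^\infty(\overline\Omega)}=\sigma$, where $f\in C^\infty(\overline\Omega)$ is regarded as the distribution on $\Omega$ that it defines. Consequently $i(fg)=i(f)\,i(g)$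 for all $f,g\in C^\infty(\overline\Omega)$. -/

import Mathlib

open TopologicalSpace MeasureTheory
open scoped Distributions SchwartzMap LineDeriv FourierTransform ContDiff Topology ENNReal NNReal

noncomputable section

namespace Colombeau

variable {n : ℕ}

/-- Euclidean space `ℝⁿ`. -/
abbrev Rn (n : ℕ) := EuclideanSpace ℝ (Fin n)

/-- `Ω` is of class `C^∞`: it is of class `C^k` for every `k`, i.e. every boundary point has a ball
`B` around it and a `C^k` diffeomorphism `Ψ` of `B` onto an open set `D` that takes `B ∩ Ω` into an
open half space and `B ∩ ∂Ω` into its boundary hyperplane. -/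
def IsSmoothDomain (Ω : Opens (Rn n)) : Prop :=
  ∀ k : ℕ, ∀ x₀ ∈ frontier (Ω : Set (Rn n)),
    ∃ r > 0, ∃ (Ψ : OpenPartialHomeomorph (Rn n) (Rn n)) (j : Fin n),
      Ψ.source = Metric.ball x₀ r ∧
      (∀ x ∈ Metric.ball x₀ r ∩ (Ω : Set (Rn n)), 0 < Ψ x j) ∧
      (∀ x ∈ Metric.ball x₀ r ∩ frontier (Ω : Set (Rn n)), Ψ x j = 0) ∧
      ContDiffOn ℝ k Ψ Ψ.source ∧ ContDiffOn ℝ k Ψ.symm Ψ.target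

section SmoothFunctions

/-- Extension by zero of a function on `Ω̄` (an auxiliary device: only its values on `Ω̄` and its
derivatives in `Ω` are ever used). -/
def zeroExt {Ω : Opens (Rn n)} (f : closure (Ω : Set (Rn n)) → ℂ) : Rn n → ℂ :=
  Function.extend Subtype.val f 0

variable {Ω : Opens (Rn n)}

theorem zeroExt_apply (f : closure (Ω : Set (Rn n)) → ℂ) (x : closure (Ω : Set (Rn n))) :
    zeroExt f x = f x :=
  Subtype.val_injective.extend_apply _ _ _

theorem zeroExt_of_mem (f : closure (Ω : Set (Rn n)) → ℂ) {x : Rn n}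
    (hx : x ∈ closure (Ω : Set (Rn n))) : zeroExt f x = f ⟨x, hx⟩ :=
  zeroExt_apply f ⟨x, hx⟩

theorem zeroExt_eqOn {f : closure (Ω : Set (Rn n)) → ℂ} {g : Rn n → ℂ}
    (h : ∀ x : closure (Ω : Set (Rn n)), f x = g x) :
    Set.EqOn (zeroExt f) g (closure (Ω : Set (Rn n))) := fun x hx => by
  rw [zeroExt_of_mem f hx, h]

variable (Ω) in
/-- `C^∞(Ω̄)`, the algebra of complex functions on `Ω̄` that are smooth up to the boundary. -/
def SmoothClosure : Subalgebra ℂ (closure (Ω : Set (Rn n)) → ℂ) where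
  carrier := {f | ContDiffOn ℝ ∞ (zeroExt f) (closure (Ω : Set (Rn n)))}
  mul_mem' {f g} hf hg := (ContDiffOn.mul hf hg).congr <| zeroExt_eqOn fun x => by
    simp [zeroExt_apply]
  add_mem' {f g} hf hg := (ContDiffOn.add hf hg).congr <| zeroExt_eqOn fun x => by
    simp [zeroExt_apply]
  algebraMap_mem' c := (contDiffOn_const (c := c)).congr <| zeroExt_eqOn fun x => rfl

/-- `μ_k(f) = sup {|D^α f(x)| : |α| ≤ k, x ∈ Ω̄}`, in the equivalent form of the supremum of the
norms of the total derivatives of order at most `k` (over `Ω`, which is dense in `Ω̄`). -/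
def mu (k : ℕ) (f : SmoothClosure Ω) : ℝ≥0∞ :=
  ⨆ (j : ℕ) (_ : j ≤ k) (x : Rn n) (_ : x ∈ Ω), ‖iteratedFDeriv ℝ j (zeroExt f.1) x‖ₑ

theorem enorm_le_mu (f : SmoothClosure Ω) {j k : ℕ} (hj : j ≤ k) {x : Rn n} (hx : x ∈ Ω) :
    ‖iteratedFDeriv ℝ j (zeroExt f.1) x‖ₑ ≤ mu k f :=
  le_iSup₂_of_le j hj (le_iSup₂_of_le (f := fun x (_ : x ∈ Ω) =>
    ‖iteratedFDeriv ℝ j (zeroExt f.1) x‖ₑ) x hx le_rfl)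

theorem mu_le {k : ℕ} {f : SmoothClosure Ω} {M : ℝ≥0∞}
    (h : ∀ j ≤ k, ∀ x ∈ Ω, ‖iteratedFDeriv ℝ j (zeroExt f.1) x‖ₑ ≤ M) : mu k f ≤ M :=
  iSup₂_le fun j hj => iSup₂_le fun x hx => h j hj x hx

theorem contDiffAt_zeroExt (f : SmoothClosure Ω) {x : Rn n} (hx : x ∈ Ω) :
    ContDiffAt ℝ ∞ (zeroExt f.1) x :=
  ContDiffOn.contDiffAt f.2 (Filter.mem_of_superset (Ω.isOpen.mem_nhds hx) subset_closure)

theorem zeroExt_eventuallyEq {f : closure (Ω : Set (Rn n)) → ℂ} {g : Rn n → ℂ}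
    (h : ∀ x : closure (Ω : Set (Rn n)), f x = g x) {x : Rn n} (hx : x ∈ Ω) :
    zeroExt f =ᶠ[𝓝 x] g :=
  Filter.eventually_of_mem (Ω.isOpen.mem_nhds hx) fun _ hy => zeroExt_eqOn h (subset_closure hy)

theorem mu_add_le (k : ℕ) (f g : SmoothClosure Ω) : mu k (f + g) ≤ mu k f + mu k g := by
  refine mu_le fun j hj x hx => ?_
  have e : zeroExt (f + g).1 =ᶠ[𝓝 x]
      zeroExt f.1 + zeroExt g.1 :=
    zeroExt_eventuallyEq (fun y => by simp [zeroExt_apply]) hx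
  rw [(e.iteratedFDeriv ℝ j).eq_of_nhds, iteratedFDeriv_add_apply
    ((contDiffAt_zeroExt f hx).of_le (by exact_mod_cast le_top))
    ((contDiffAt_zeroExt g hx).of_le (by exact_mod_cast le_top))]
  exact (enorm_add_le _ _).trans (add_le_add (enorm_le_mu f hj hx) (enorm_le_mu g hj hx))

theorem mu_algebraMap_le (k : ℕ) (c : ℂ) :
    mu k (algebraMap ℂ (SmoothClosure Ω) c) ≤ ‖c‖ₑ := by
  refine mu_le fun j hj x hx => ?_
  have e : zeroExt (algebraMap ℂ (SmoothClosure Ω) c).1 =ᶠ[𝓝 x]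
      fun _ => c := zeroExt_eventuallyEq (g := fun _ => c) (fun y => rfl) hx
  rw [(e.iteratedFDeriv ℝ j).eq_of_nhds]
  rcases Nat.eq_zero_or_pos j with rfl | hj
  · rw [← ofReal_norm, ← ofReal_norm, norm_iteratedFDeriv_zero]
  · simp [iteratedFDeriv_const_of_ne hj.ne']

theorem mu_mul_le (k : ℕ) (f g : SmoothClosure Ω) :
    mu k (f * g) ≤ 2 ^ k * (mu k f * mu k g) := by
  refine mu_le fun j hj x hx => ?_
  have hU : UniqueDiffOn ℝ (Ω : Set (Rn n)) := Ω.isOpen.uniqueDiffOn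
  have e : zeroExt (f * g).1 =ᶠ[𝓝 x]
      fun y => zeroExt f.1 y * zeroExt g.1 y :=
    zeroExt_eventuallyEq (fun y => by simp [zeroExt_apply]) hx
  have key := norm_iteratedFDerivWithin_mul_le (n := j) (N := (⊤ : ℕ∞))
    (f.2.mono subset_closure) (g.2.mono subset_closure) hU hx (by exact_mod_cast le_top)
  simp only [iteratedFDerivWithin_of_isOpen _ Ω.isOpen hx] at key
  rw [(e.iteratedFDeriv ℝ j).eq_of_nhds]
  calc ‖iteratedFDeriv ℝ j (fun y => zeroExt f.1 y * zeroExt g.1 y) x‖ₑ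
      ≤ ∑ i ∈ Finset.range (j + 1), (j.choose i : ℝ≥0∞) *
        ‖iteratedFDeriv ℝ i (zeroExt f.1) x‖ₑ *
          ‖iteratedFDeriv ℝ (j - i) (zeroExt g.1) x‖ₑ := by
        rw [← ofReal_norm]
        refine (ENNReal.ofReal_le_ofReal key).trans_eq ?_
        rw [ENNReal.ofReal_sum_of_nonneg fun i _ => by positivity]
        refine Finset.sum_congr rfl fun i _ => ?_
        rw [ENNReal.ofReal_mul (by positivity), ENNReal.ofReal_mul (by positivity),
          ofReal_norm, ofReal_norm, ENNReal.ofReal_natCast]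
    _ ≤ ∑ i ∈ Finset.range (j + 1), (j.choose i : ℝ≥0∞) * (mu k f * mu k g) := by
        refine Finset.sum_le_sum fun i hi => ?_
        rw [mul_assoc]
        gcongr
        · exact enorm_le_mu f ((Finset.mem_range_succ_iff.1 hi).trans hj) hx
        · exact enorm_le_mu g ((Nat.sub_le _ _).trans hj) hx
    _ = 2 ^ j * (mu k f * mu k g) := by
        rw [← Finset.sum_mul]
        congr 1
        exact_mod_cast congrArg (Nat.cast (R := ℝ≥0∞)) (Nat.sum_range_choose j)
    _ ≤ 2 ^ k * (mu k f * mu k g) := by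
        gcongr
        exact one_le_two

theorem mu_smul_le (k : ℕ) (c : ℂ) (f : SmoothClosure Ω) : mu k (c • f) ≤ 2 ^ k * (‖c‖ₑ * mu k f) := by
  rw [Algebra.smul_def]
  refine (mu_mul_le k _ f).trans ?_
  gcongr
  exact mu_algebraMap_le k c

theorem mu_lt_top (hΩ : Bornology.IsBounded (Ω : Set (Rn n))) (k : ℕ) (f : SmoothClosure Ω) :
    mu k f < ⊤ := by
  have main : ∀ j : ℕ, ∃ M : ℝ, ∀ x ∈ Ω, ‖iteratedFDeriv ℝ j (zeroExt f.1) x‖ ≤ M := by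
    intro j
    have hc : IsCompact (closure (Ω : Set (Rn n))) := hΩ.isCompact_closure
    suffices ∃ M : ℝ, ∀ x ∈ closure (Ω : Set (Rn n)) ∩ Ω,
        ‖iteratedFDeriv ℝ j (zeroExt f.1) x‖ ≤ M by
      obtain ⟨M, hM⟩ := this
      exact ⟨M, fun x hx => hM x ⟨subset_closure hx, hx⟩⟩
    refine hc.induction_on
      (p := fun s => ∃ M : ℝ, ∀ x ∈ s ∩ Ω, ‖iteratedFDeriv ℝ j (zeroExt f.1) x‖ ≤ M)
      ⟨0, by simp⟩ (fun s t hst ⟨M, hM⟩ => ⟨M, fun x hx => hM x ⟨hst hx.1, hx.2⟩⟩)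
      (fun s t ⟨M, hM⟩ ⟨N, hN⟩ => ⟨max M N, fun x hx => hx.1.elim
        (fun h => (hM x ⟨h, hx.2⟩).trans (le_max_left _ _))
        (fun h => (hN x ⟨h, hx.2⟩).trans (le_max_right _ _))⟩) ?_
    intro x hx
    obtain ⟨u, hu, p, hp⟩ := f.2 x hx j (by exact_mod_cast le_top)
    rw [Set.insert_eq_of_mem hx] at hu
    have hxu : x ∈ u := mem_of_mem_nhdsWithin hx hu
    have hcont := (hp.cont j le_rfl) x hxu
    obtain ⟨v, hv, hvu⟩ := mem_nhdsWithin_iff_exists_mem_nhds_inter.1 hu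
    have hb : {y | ‖p y j‖ < ‖p x j‖ + 1} ∈ 𝓝[closure (Ω : Set (Rn n))] x :=
      nhdsWithin_le_of_mem hu (hcont.norm.eventually (gt_mem_nhds (lt_add_one _)))
    obtain ⟨w, hw, hwv⟩ := mem_nhds_iff.1 hv
    refine ⟨w ∩ {y | ‖p y j‖ < ‖p x j‖ + 1}, Filter.inter_mem
      (mem_nhdsWithin_of_mem_nhds (hwv.1.mem_nhds hwv.2)) hb, ‖p x j‖ + 1, ?_⟩
    rintro y ⟨⟨hyw, hy⟩, hyΩ⟩
    have hO : IsOpen (w ∩ (Ω : Set (Rn n))) := hwv.1.inter Ω.isOpen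
    have hp' := hp.mono (t := w ∩ (Ω : Set (Rn n)))
      (fun z hz => hvu ⟨hw hz.1, subset_closure hz.2⟩)
    have := hp'.eq_iteratedFDerivWithin_of_uniqueDiffOn le_rfl hO.uniqueDiffOn ⟨hyw, hyΩ⟩
    rw [iteratedFDerivWithin_of_isOpen j hO ⟨hyw, hyΩ⟩] at this
    rw [← this]
    exact hy.le
  choose M hM using main
  refine lt_of_le_of_lt (b := ∑ j ∈ Finset.range (k + 1), ENNReal.ofReal (M j))
    (mu_le fun j hj x hx => ?_) (ENNReal.sum_lt_top.2 fun _ _ => ENNReal.ofReal_lt_top)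
  rw [← ofReal_norm]
  exact (ENNReal.ofReal_le_ofReal (hM j x hx)).trans (Finset.single_le_sum
    (f := fun j => ENNReal.ofReal (M j)) (fun _ _ => zero_le) (Finset.mem_range_succ_iff.2 hj))

end SmoothFunctions

section Algebra

/-- The index set `I = (0,1]`. -/
abbrev I01 := Set.Ioc (0 : ℝ) 1

/-- `m(ε) = O(ε^a)` as `ε → 0`. -/
def IsBigOPow (m : I01 → ℝ≥0∞) (a : ℝ) : Prop :=
  ∃ C : ℝ≥0, ∃ ε₀ > (0 : ℝ), ∀ ε : I01, (ε : ℝ) < ε₀ → m ε ≤ C * ENNReal.ofReal ((ε : ℝ) ^ a)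

theorem IsBigOPow.mono {m m' : I01 → ℝ≥0∞} {a : ℝ} (C : ℝ≥0) (h : IsBigOPow m a)
    (hm : ∀ ε, m' ε ≤ C * m ε) : IsBigOPow m' a := by
  obtain ⟨D, e, he, H⟩ := h
  refine ⟨C * D, e, he, fun ε hε => (hm ε).trans ?_⟩
  rw [ENNReal.coe_mul, mul_assoc]
  gcongr
  exact H ε hε

theorem IsBigOPow.of_le {m : I01 → ℝ≥0∞} {a b : ℝ} (h : IsBigOPow m a) (hab : b ≤ a) :
    IsBigOPow m b := by
  obtain ⟨D, e, he, H⟩ := h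
  refine ⟨D, e, he, fun ε hε => (H ε hε).trans (mul_le_mul_right (ENNReal.ofReal_le_ofReal ?_) _)⟩
  exact Real.rpow_le_rpow_of_exponent_ge ε.2.1 ε.2.2 hab

theorem IsBigOPow.add {m m' : I01 → ℝ≥0∞} {a : ℝ} (h : IsBigOPow m a) (h' : IsBigOPow m' a) :
    IsBigOPow (fun ε => m ε + m' ε) a := by
  obtain ⟨D, e, he, H⟩ := h
  obtain ⟨D', e', he', H'⟩ := h'
  refine ⟨D + D', min e e', lt_min he he', fun ε hε => ?_⟩
  rw [ENNReal.coe_add, add_mul]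
  exact add_le_add (H ε (hε.trans_le (min_le_left _ _))) (H' ε (hε.trans_le (min_le_right _ _)))

theorem IsBigOPow.mul {m m' : I01 → ℝ≥0∞} {a b : ℝ} (h : IsBigOPow m a) (h' : IsBigOPow m' b) :
    IsBigOPow (fun ε => m ε * m' ε) (a + b) := by
  obtain ⟨D, e, he, H⟩ := h
  obtain ⟨D', e', he', H'⟩ := h'
  refine ⟨D * D', min e e', lt_min he he', fun ε hε => ?_⟩
  refine (mul_le_mul' (H ε (hε.trans_le (min_le_left _ _)))
    (H' ε (hε.trans_le (min_le_right _ _)))).trans_eq ?_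
  rw [Real.rpow_add ε.2.1, ENNReal.ofReal_mul (Real.rpow_nonneg ε.2.1.le _), ENNReal.coe_mul]
  ring

theorem isBigOPow_const (C : ℝ≥0) : IsBigOPow (fun _ => (C : ℝ≥0∞)) 0 :=
  ⟨C, 1, one_pos, fun ε _ => by simp⟩

variable (Ω : Opens (Rn n))

/-- The moderate nets `ℰ_M(Ω̄)`. -/
def Moderate : Subalgebra ℂ (I01 → SmoothClosure Ω) where
  carrier := {u | ∀ k : ℕ, ∃ a : ℝ, IsBigOPow (fun ε => mu k (u ε)) a}
  mul_mem' {u v} hu hv k := by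
    obtain ⟨a, ha⟩ := hu k
    obtain ⟨b, hb⟩ := hv k
    exact ⟨a + b, (ha.mul hb).mono (2 ^ k) fun ε => by simpa using mu_mul_le k (u ε) (v ε)⟩
  add_mem' {u v} hu hv k := by
    obtain ⟨a, ha⟩ := hu k
    obtain ⟨b, hb⟩ := hv k
    exact ⟨min a b, ((ha.of_le (min_le_left _ _)).add (hb.of_le (min_le_right _ _))).mono 1
      fun ε => by simpa using mu_add_le k (u ε) (v ε)⟩
  algebraMap_mem' c k := ⟨0, (isBigOPow_const ‖c‖₊).mono 1 fun ε => by
    simpa [enorm_eq_nnnorm] using mu_algebraMap_le (Ω := Ω) k c⟩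

instance : CommRing (Moderate Ω) := inferInstance

/-- The null nets `𝒩(Ω̄)`, an ideal of `ℰ_M(Ω̄)`. -/
def Null : Ideal (Moderate Ω) where
  carrier := {u | ∀ k : ℕ, ∀ a : ℝ, IsBigOPow (fun ε => mu k ((u : I01 → SmoothClosure Ω) ε)) a}
  zero_mem' k a := ⟨0, 1, one_pos, fun ε _ => by
    have := mu_algebraMap_le (Ω := Ω) k 0
    simpa using this⟩
  add_mem' {u v} hu hv k a := ((hu k a).add (hv k a)).mono 1 fun ε => by
    simpa using mu_add_le k ((u : I01 → SmoothClosure Ω) ε) ((v : I01 → SmoothClosure Ω) ε)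
  smul_mem' c u hu k a := by
    obtain ⟨b, hb⟩ := c.2 k
    have := (hb.mul (hu k (a - b))).mono (2 ^ k) fun ε => by
      simpa using mu_mul_le k ((c : I01 → SmoothClosure Ω) ε) ((u : I01 → SmoothClosure Ω) ε)
    simpa using this

/-- The algebra of generalized functions `𝒢(Ω̄) = ℰ_M(Ω̄) / 𝒩(Ω̄)`. -/
abbrev GenFun := Moderate Ω ⧸ Null Ω

variable {Ω}

/-- The embedding `σ : C^∞(Ω̄) → 𝒢(Ω̄)` by constant nets. -/
def sigma (hΩ : Bornology.IsBounded (Ω : Set (Rn n))) : SmoothClosure Ω →ₐ[ℂ] GenFun Ω :=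
  (Ideal.Quotient.mkₐ ℂ (Null Ω)).comp <|
    (Pi.constAlgHom ℂ I01 (SmoothClosure Ω)).codRestrict (Moderate Ω) fun f k =>
      ⟨0, (isBigOPow_const (mu k f).toNNReal).mono 1 fun ε => by
        rw [ENNReal.coe_one, one_mul, ENNReal.coe_toNNReal (mu_lt_top hΩ k f).ne]; rfl⟩

end Algebra


section Convolution

/-- `φ_ε(x) = ε^{-n} φ(x/ε)`. -/
def dilate (φ : 𝓢(Rn n, ℂ)) (ε : I01) : 𝓢(Rn n, ℂ) :=
  (((ε : ℝ) : ℂ) ^ n)⁻¹ • SchwartzMap.compCLMOfContinuousLinearEquiv ℂ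
    (ContinuousLinearEquiv.smulLeft (Units.mk0 (ε : ℝ)⁻¹ (inv_ne_zero ε.2.1.ne')) :
      Rn n ≃L[ℝ] Rn n) φ

theorem dilate_apply (φ : 𝓢(Rn n, ℂ)) (ε : I01) (x : Rn n) :
    dilate φ ε x = (((ε : ℝ) : ℂ) ^ n)⁻¹ * φ ((ε : ℝ)⁻¹ • x) := rfl

/-- The function `y ↦ φ(x - y)`. -/
def reflectAt (x : Rn n) (φ : 𝓢(Rn n, ℂ)) : 𝓢(Rn n, ℂ) :=
  SchwartzMap.compSubConstCLM ℂ x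
    (SchwartzMap.compCLMOfContinuousLinearEquiv ℂ (ContinuousLinearEquiv.neg ℝ) φ)

theorem reflectAt_apply (x : Rn n) (φ : 𝓢(Rn n, ℂ)) (y : Rn n) :
    reflectAt x φ y = φ (x - y) := by
  simp [reflectAt]

/-- The convolution `(T * φ)(x) = ⟨T, φ(x - ·)⟩` of a tempered distribution with a Schwartz
function. -/
def conv (T : 𝓢'(Rn n, ℂ)) (φ : 𝓢(Rn n, ℂ)) (x : Rn n) : ℂ := T (reflectAt x φ)

theorem lineDerivOp_swap (g : 𝓢(Rn n, ℂ)) (h v : Rn n) :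
    (∂_{h} (∂_{v} g : 𝓢(Rn n, ℂ)) : 𝓢(Rn n, ℂ)) = ∂_{v} (∂_{h} g : 𝓢(Rn n, ℂ)) := by
  ext y
  have aux : ∀ a b : Rn n, (∂_{a} (∂_{b} g : 𝓢(Rn n, ℂ)) : 𝓢(Rn n, ℂ)) y
      = fderiv ℝ (fderiv ℝ g) y a b := by
    intro a b
    rw [SchwartzMap.lineDerivOp_apply_eq_fderiv]
    have : (∂_{b} g : 𝓢(Rn n, ℂ)) = fun z => fderiv ℝ g z b :=
      funext fun z => SchwartzMap.lineDerivOp_apply_eq_fderiv b g z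
    rw [this, fderiv_clm_apply]
    · simp
    · exact ((g.smooth 2).fderiv_right (m := 1) (by norm_num)).differentiable (by norm_num) y
    · fun_prop
  rw [aux, aux]
  exact (g.contDiffAt 2).isSymmSndFDerivAt (by simp) h v

theorem fderiv_iteratedFDeriv_apply (g : 𝓢(Rn n, ℂ)) (l : ℕ) (h y : Rn n) :
    fderiv ℝ (iteratedFDeriv ℝ l g) y h =
      iteratedFDeriv ℝ l (∂_{h} g : 𝓢(Rn n, ℂ)) y := by
  ext m
  have h1 : ∀ (l : ℕ) (m : Fin l → Rn n), (∂^{m} (∂_{h} g : 𝓢(Rn n, ℂ)) : 𝓢(Rn n, ℂ)) =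
      ∂_{h} (∂^{m} g : 𝓢(Rn n, ℂ)) := by
    intro l
    induction l with
    | zero => intro m; rfl
    | succ l ih =>
      intro m
      rw [LineDeriv.iteratedLineDerivOp_succ_left, ih, lineDerivOp_swap,
        LineDeriv.iteratedLineDerivOp_succ_left]
  have h2 : fderiv ℝ (iteratedFDeriv ℝ l g) y h m =
      iteratedFDeriv ℝ (l + 1) g y (Fin.cons h m : Fin (l + 1) → Rn n) := by
    simp [iteratedFDeriv_succ_apply_left]
  rw [h2, ← SchwartzMap.iteratedLineDerivOp_eq_iteratedFDeriv,
    ← SchwartzMap.iteratedLineDerivOp_eq_iteratedFDeriv, h1,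
    LineDeriv.iteratedLineDerivOp_succ_left]
  simp

theorem norm_iteratedFDeriv_two_iteratedFDeriv (g : Rn n → ℂ) (l : ℕ) (z : Rn n) :
    ‖iteratedFDeriv ℝ 2 (iteratedFDeriv ℝ l g) z‖ = ‖iteratedFDeriv ℝ (l + 2) g z‖ := by
  rw [← norm_iteratedFDeriv_fderiv, fderiv_iteratedFDeriv,
    LinearIsometryEquiv.norm_iteratedFDeriv_comp_left, ← norm_iteratedFDeriv_fderiv,
    norm_iteratedFDeriv_zero, norm_fderiv_iteratedFDeriv]

theorem norm_taylor_le {V : Type*} [NormedAddCommGroup V] [NormedSpace ℝ V] {G : Rn n → V}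
    (hGs : ContDiff ℝ ∞ G) (y h : Rn n) {M : ℝ} (hM0 : 0 ≤ M)
    (b2 : ∀ z ∈ Metric.closedBall y ‖h‖, ‖iteratedFDeriv ℝ 2 G z‖ ≤ M) :
    ‖G (y + h) - G y - fderiv ℝ G y h‖ ≤ M * ‖h‖ * ‖h‖ := by
  have b2' : ∀ z ∈ Metric.closedBall y ‖h‖, ‖fderiv ℝ (fderiv ℝ G) z‖ ≤ M := by
    intro z hz
    have := b2 z hz
    rwa [← norm_iteratedFDeriv_fderiv, ← norm_iteratedFDeriv_fderiv,
      norm_iteratedFDeriv_zero] at this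
  have hd : Differentiable ℝ (fderiv ℝ G) :=
    ((contDiff_infty.1 hGs 2).fderiv_right (m := 1) (by norm_num)).differentiable (by norm_num)
  have hseg : ∀ z ∈ Metric.closedBall y ‖h‖, ‖fderiv ℝ G z - fderiv ℝ G y‖ ≤ M * ‖h‖ := by
    intro z hz
    have := (convex_closedBall y ‖h‖).norm_image_sub_le_of_norm_fderiv_le (𝕜 := ℝ)
      (f := fderiv ℝ G) (C := M) (fun w _ => hd w) b2'
      (Metric.mem_closedBall_self (norm_nonneg h)) hz
    refine this.trans ?_
    gcongr
    simpa [dist_eq_norm] using hz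
  have hfin := (convex_closedBall y ‖h‖).norm_image_sub_le_of_norm_fderiv_le' (𝕜 := ℝ)
      (f := G) (φ := fderiv ℝ G y) (fun w _ => (hGs.differentiable (by norm_num)) w) hseg
      (Metric.mem_closedBall_self (norm_nonneg h)) (y := y + h) (by simp)
  rwa [add_sub_cancel_left] at hfin

theorem norm_iteratedFDeriv_le (g : 𝓢(Rn n, ℂ)) (k l : ℕ) :
    ∃ B : ℝ, 0 ≤ B ∧ ∀ x, ‖iteratedFDeriv ℝ l g x‖ ≤ B / (1 + ‖x‖) ^ k := by
  refine ⟨2 ^ k * (Finset.Iic (k, l)).sup (fun m => SchwartzMap.seminorm ℂ m.1 m.2) g,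
    by positivity, fun x => ?_⟩
  rw [le_div_iff₀ (by positivity), mul_comm]
  exact SchwartzMap.one_add_le_sup_seminorm_apply (m := (k, l)) le_rfl le_rfl g x

theorem seminorm_taylor (g : 𝓢(Rn n, ℂ)) (k l : ℕ) :
    ∃ C : ℝ, 0 ≤ C ∧ ∀ h : Rn n, ‖h‖ ≤ 1 →
      SchwartzMap.seminorm ℂ k l (SchwartzMap.compSubConstCLM ℂ (-h) g - g - (∂_{h} g : 𝓢(Rn n, ℂ))) ≤
        C * ‖h‖ ^ 2 := by
  obtain ⟨B, hB, hg⟩ := norm_iteratedFDeriv_le g k (l + 2)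
  refine ⟨B * 2 ^ k, by positivity, fun h hh => ?_⟩
  refine SchwartzMap.seminorm_le_bound ℂ k l _ (by positivity) fun y => ?_
  set G := iteratedFDeriv ℝ l g with hG
  have hGs : ContDiff ℝ ∞ G := by
    apply (g.smooth ⊤).iteratedFDeriv_right (m := (⊤ : ℕ∞)) (i := l); exact_mod_cast le_top
  have e : iteratedFDeriv ℝ l (SchwartzMap.compSubConstCLM ℂ (-h) g - g -
      (∂_{h} g : 𝓢(Rn n, ℂ)) : 𝓢(Rn n, ℂ)) y = G (y + h) - G y - fderiv ℝ G y h := by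
    have s1 : ((SchwartzMap.compSubConstCLM ℂ (-h) g - g - (∂_{h} g : 𝓢(Rn n, ℂ)) :
      𝓢(Rn n, ℂ)) : Rn n → ℂ) =
      ((fun z => g (z + h)) - (g : Rn n → ℂ)) - (∂_{h} g : 𝓢(Rn n, ℂ)) := by ext z; simp
    have c1 : ContDiff ℝ l (fun z => g (z + h)) := (g.smooth l).comp (contDiff_id.add contDiff_const)
    have c2 : ContDiff ℝ l ((fun z => g (z + h)) - (g : Rn n → ℂ)) := c1.sub (g.smooth l)
    rw [s1, iteratedFDeriv_sub_apply c2.contDiffAt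
      ((∂_{h} g : 𝓢(Rn n, ℂ)).smooth l).contDiffAt,
      iteratedFDeriv_sub_apply c1.contDiffAt (g.smooth l).contDiffAt, iteratedFDeriv_comp_add_right,
      fderiv_iteratedFDeriv_apply]
  rw [e]
  have key := norm_taylor_le hGs y h (M := B * 2 ^ k / (1 + ‖y‖) ^ k) (by positivity) <| by
    intro z hz
    have hz' : ‖y‖ ≤ ‖z‖ + 1 := by
      have h1 := norm_sub_norm_le y z
      rw [norm_sub_rev] at h1
      have h2 : ‖z - y‖ ≤ ‖h‖ := by simpa [dist_eq_norm] using hz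
      linarith
    rw [norm_iteratedFDeriv_two_iteratedFDeriv]
    refine (hg z).trans ?_
    rw [div_le_div_iff₀ (by positivity) (by positivity), mul_assoc, ← mul_pow]
    gcongr
    linarith [norm_nonneg z]
  calc ‖y‖ ^ k * ‖G (y + h) - G y - fderiv ℝ G y h‖
      ≤ (1 + ‖y‖) ^ k * (B * 2 ^ k / (1 + ‖y‖) ^ k * ‖h‖ * ‖h‖) := by
        gcongr
        linarith
    _ = B * 2 ^ k * ‖h‖ ^ 2 := by
        field_simp

theorem exists_bound (T : 𝓢'(Rn n, ℂ)) : ∃ (s : Finset (ℕ × ℕ)) (C : ℝ), 0 ≤ C ∧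
    ∀ g : 𝓢(Rn n, ℂ), ‖T g‖ ≤ C * ∑ p ∈ s, SchwartzMap.seminorm ℂ p.1 p.2 g := by
  let L : 𝓢(Rn n, ℂ) →ₗ[ℂ] ℂ :=
    { toFun := fun g => T g, map_add' := map_add T, map_smul' := map_smul T }
  obtain ⟨s, C, -, h⟩ := Seminorm.bound_of_continuous (schwartz_withSeminorms ℂ (Rn n) ℂ)
    ((normSeminorm ℂ ℂ).comp L) (continuous_norm.comp (map_continuous T))
  refine ⟨s, C, C.2, fun g => (h g).trans ?_⟩
  change (C : ℝ) * (s.sup (schwartzSeminormFamily ℂ (Rn n) ℂ)) g ≤ _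
  gcongr
  refine (Seminorm.finset_sup_le_sum _ s g).trans_eq ?_
  simp [schwartzSeminormFamily]

theorem conv_add (T : 𝓢'(Rn n, ℂ)) (φ χ : 𝓢(Rn n, ℂ)) (x : Rn n) :
    conv T (φ + χ) x = conv T φ x + conv T χ x := by
  simp [conv, reflectAt]

theorem conv_smul (T : 𝓢'(Rn n, ℂ)) (c : ℂ) (φ : 𝓢(Rn n, ℂ)) (x : Rn n) :
    conv T (c • φ) x = c * conv T φ x := by
  simp [conv, reflectAt]

/-- The total derivative of `T * φ`, namely `h ↦ T * ∂_h φ`. -/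
def convDeriv (T : 𝓢'(Rn n, ℂ)) (φ : 𝓢(Rn n, ℂ)) (x : Rn n) : Rn n →L[ℝ] ℂ :=
  LinearMap.toContinuousLinearMap
    { toFun := fun h => conv T (∂_{h} φ : 𝓢(Rn n, ℂ)) x
      map_add' := fun h v => by rw [LineDeriv.lineDerivOp_left_add, conv_add]
      map_smul' := fun c h => by
        rw [LineDeriv.lineDerivOp_left_smul]
        have : (c • (∂_{h} φ : 𝓢(Rn n, ℂ))) = (c : ℂ) • (∂_{h} φ : 𝓢(Rn n, ℂ)) := by
          ext y; simp
        rw [this, conv_smul]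
        simp }

theorem convDeriv_apply (T : 𝓢'(Rn n, ℂ)) (φ : 𝓢(Rn n, ℂ)) (x h : Rn n) :
    convDeriv T φ x h = conv T (∂_{h} φ : 𝓢(Rn n, ℂ)) x := rfl

theorem lineDeriv_reflectAt (φ : 𝓢(Rn n, ℂ)) (x h : Rn n) :
    (∂_{-h} (reflectAt x φ) : 𝓢(Rn n, ℂ)) = reflectAt x (∂_{h} φ : 𝓢(Rn n, ℂ)) := by
  ext y
  rw [SchwartzMap.lineDerivOp_apply_eq_fderiv, reflectAt_apply,
    SchwartzMap.lineDerivOp_apply_eq_fderiv]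
  have e : (reflectAt x φ : Rn n → ℂ) = fun z => φ (x - z) := funext fun z => reflectAt_apply x φ z
  have hd : HasFDerivAt (fun z => φ (x - z)) (-(fderiv ℝ φ (x - y))) y := by
    have h1 : HasFDerivAt (fun z : Rn n => x - z) (-(ContinuousLinearMap.id ℝ (Rn n))) y := by
      simpa using (hasFDerivAt_id y).const_sub x
    have := (φ.hasFDerivAt (x - y)).comp y h1
    rw [ContinuousLinearMap.comp_neg, ContinuousLinearMap.comp_id] at this
    exact this
  rw [e, hd.fderiv]
  simp

theorem hasFDerivAt_conv (T : 𝓢'(Rn n, ℂ)) (φ : 𝓢(Rn n, ℂ)) (x : Rn n) :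
    HasFDerivAt (conv T φ) (convDeriv T φ x) x := by
  obtain ⟨s, C, hC, hT⟩ := exists_bound T
  choose D hD0 hD using fun p : ℕ × ℕ => seminorm_taylor (reflectAt x φ) p.1 p.2
  have key : ∀ h : Rn n, ‖h‖ ≤ 1 → ‖conv T φ (x + h) - conv T φ x - convDeriv T φ x h‖ ≤
      (C * ∑ p ∈ s, D p) * ‖h‖ ^ 2 := by
    intro h hh
    have e : conv T φ (x + h) - conv T φ x - convDeriv T φ x h =
        T (SchwartzMap.compSubConstCLM ℂ (-(-h)) (reflectAt x φ) - reflectAt x φ -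
          (∂_{-h} (reflectAt x φ) : 𝓢(Rn n, ℂ))) := by
      rw [convDeriv_apply, conv, conv, conv, ← map_sub, ← map_sub, lineDeriv_reflectAt]
      congr 3
      ext y
      simp only [reflectAt_apply, SchwartzMap.compSubConstCLM_apply, neg_neg]
      congr 1
      abel
    rw [e]
    refine (hT _).trans ?_
    rw [mul_assoc, Finset.sum_mul]
    gcongr with p hp
    simpa using hD p (-h) (by simpa using hh)
  rw [hasFDerivAt_iff_isLittleO_nhds_zero]
  have hO : (fun h => conv T φ (x + h) - conv T φ x - convDeriv T φ x h) =O[𝓝 0]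
      fun h => ‖h‖ ^ 2 := by
    refine Asymptotics.IsBigO.of_bound (C * ∑ p ∈ s, D p) ?_
    filter_upwards [Metric.closedBall_mem_nhds (0 : Rn n) one_pos] with h hh
    simpa using key h (by simpa using hh)
  refine hO.trans_isLittleO ?_
  simpa using (Asymptotics.isLittleO_norm_pow_id (E' := Rn n) one_lt_two)

theorem contDiff_conv (T : 𝓢'(Rn n, ℂ)) (φ : 𝓢(Rn n, ℂ)) : ContDiff ℝ ∞ (conv T φ) := by
  rw [contDiff_infty]
  intro m
  induction m generalizing φ with
  | zero =>
    exact contDiff_zero.2 (continuous_iff_continuousAt.2 fun x =>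
      (hasFDerivAt_conv T φ x).continuousAt)
  | succ m ih =>
    have hf : fderiv ℝ (conv T φ) = convDeriv T φ := funext fun x => (hasFDerivAt_conv T φ x).fderiv
    push_cast
    rw [contDiff_succ_iff_fderiv_apply]
    refine ⟨fun x => (hasFDerivAt_conv T φ x).differentiableAt, by simp, fun h => ?_⟩
    rw [hf]
    exact ih (∂_{h} φ)

theorem lineDeriv_dilate (φ : 𝓢(Rn n, ℂ)) (ε : I01) (h : Rn n) :
    (∂_{h} (dilate φ ε) : 𝓢(Rn n, ℂ)) =
      (((ε : ℝ) : ℂ))⁻¹ • dilate (∂_{h} φ : 𝓢(Rn n, ℂ)) ε := by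
  ext y
  have hd : HasFDerivAt (dilate φ ε) ((((ε : ℝ) : ℂ) ^ n)⁻¹ • (fderiv ℝ φ ((ε : ℝ)⁻¹ • y)).comp
      ((ε : ℝ)⁻¹ • ContinuousLinearMap.id ℝ (Rn n))) y := by
    have h1 : HasFDerivAt (fun z : Rn n => (ε : ℝ)⁻¹ • z)
      ((ε : ℝ)⁻¹ • ContinuousLinearMap.id ℝ (Rn n)) y :=
      ((ε : ℝ)⁻¹ • ContinuousLinearMap.id ℝ (Rn n)).hasFDerivAt
    exact ((φ.hasFDerivAt ((ε : ℝ)⁻¹ • y)).comp y h1).const_smul _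
  rw [SchwartzMap.lineDerivOp_apply_eq_fderiv, hd.fderiv]
  simp [dilate_apply, SchwartzMap.lineDerivOp_apply_eq_fderiv]
  ring

theorem seminorm_reflectAt_dilate_le (φ : 𝓢(Rn n, ℂ)) (R : ℝ) (hR : 0 ≤ R) (k l : ℕ) :
    ∃ C : ℝ, 0 ≤ C ∧ ∀ ε : I01, ∀ x : Rn n, ‖x‖ ≤ R →
      SchwartzMap.seminorm ℂ k l (reflectAt x (dilate φ ε)) ≤ C * ((ε : ℝ)⁻¹) ^ (n + l) := by
  obtain ⟨B, hB, hg⟩ := norm_iteratedFDeriv_le φ k l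
  refine ⟨(1 + R) ^ k * B, by positivity, fun ε x hx => ?_⟩
  have hε : 0 < (ε : ℝ) := ε.2.1
  refine SchwartzMap.seminorm_le_bound ℂ k l _ (by positivity) fun y => ?_
  set A : Rn n →L[ℝ] Rn n := (-(ε : ℝ)⁻¹) • ContinuousLinearMap.id ℝ (Rn n) with hA
  have hAn : ‖A‖ ≤ (ε : ℝ)⁻¹ := by
    rw [hA, norm_smul, norm_neg, norm_inv, Real.norm_of_nonneg hε.le]
    exact mul_le_of_le_one_right (by positivity) ContinuousLinearMap.norm_id_le
  have e : (reflectAt x (dilate φ ε) : Rn n → ℂ) =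
      (((ε : ℝ) : ℂ) ^ n)⁻¹ • ((fun w => φ (w + (ε : ℝ)⁻¹ • x)) ∘ A) := by
    ext z
    simp [reflectAt_apply, dilate_apply, hA, sub_eq_neg_add]
  have c1 : ContDiff ℝ ∞ (fun w => φ (w + (ε : ℝ)⁻¹ • x)) :=
    (φ.smooth ⊤).comp (contDiff_id.add contDiff_const)
  have hz : A y + (ε : ℝ)⁻¹ • x = (ε : ℝ)⁻¹ • (x - y) := by
    simp [hA, sub_eq_neg_add]
  rw [e, iteratedFDeriv_const_smul_apply ((c1.comp A.contDiff).of_le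
    (by exact_mod_cast le_top)).contDiffAt,
    A.iteratedFDeriv_comp_right c1 _ (by exact_mod_cast le_top), iteratedFDeriv_comp_add_right,
    hz, norm_smul, norm_inv, norm_pow, Complex.norm_real, Real.norm_of_nonneg hε.le]
  set w := (ε : ℝ)⁻¹ • (x - y) with hw
  have hε1 : 1 ≤ (ε : ℝ)⁻¹ := (one_le_inv₀ hε).2 ε.2.2
  have hy : ‖y‖ ≤ (1 + R) * (1 + ‖w‖) := by
    have h1 : ‖y‖ ≤ ‖x‖ + ‖x - y‖ := by
      have := norm_sub_norm_le y x
      rw [norm_sub_rev] at this; linarith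
    have h2 : ‖x - y‖ ≤ ‖w‖ := by
      rw [hw, norm_smul, norm_inv, Real.norm_of_nonneg hε.le]
      exact le_mul_of_one_le_left (norm_nonneg _) hε1
    nlinarith [norm_nonneg w]
  calc ‖y‖ ^ k * (((ε : ℝ) ^ n)⁻¹ *
        ‖(iteratedFDeriv ℝ l φ w).compContinuousLinearMap fun _ => A‖)
      ≤ ((1 + R) * (1 + ‖w‖)) ^ k * (((ε : ℝ) ^ n)⁻¹ *
        (B / (1 + ‖w‖) ^ k * ((ε : ℝ)⁻¹) ^ l)) := by
        gcongr
        refine (ContinuousMultilinearMap.norm_compContinuousLinearMap_le _ _).trans ?_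
        rw [Finset.prod_const, Finset.card_univ, Fintype.card_fin]
        gcongr
        exact hg w
    _ = (1 + R) ^ k * B * ((ε : ℝ)⁻¹) ^ (n + l) := by
        rw [mul_pow, pow_add, inv_pow, inv_pow]
        field_simp

theorem iteratedFDeriv_conv_dilate_le (T : 𝓢'(Rn n, ℂ)) (R : ℝ) (hR : 0 ≤ R) (j : ℕ)
    (φ : 𝓢(Rn n, ℂ)) : ∃ (C : ℝ) (a : ℕ), 0 ≤ C ∧ ∀ ε : I01, ∀ x : Rn n, ‖x‖ ≤ R →
      ‖iteratedFDeriv ℝ j (conv T (dilate φ ε)) x‖ ≤ C * ((ε : ℝ)⁻¹) ^ a := by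
  induction j generalizing φ with
  | zero =>
    obtain ⟨s, C, hC, hT⟩ := exists_bound T
    choose D hD0 hD using fun p : ℕ × ℕ => seminorm_reflectAt_dilate_le φ R hR p.1 p.2
    refine ⟨C * ∑ p ∈ s, D p, n + s.sup Prod.snd,
      mul_nonneg hC (Finset.sum_nonneg fun p _ => hD0 p), fun ε x hx => ?_⟩
    have hε1 : 1 ≤ (ε : ℝ)⁻¹ := (one_le_inv₀ ε.2.1).2 ε.2.2
    rw [norm_iteratedFDeriv_zero, conv]
    refine (hT _).trans ?_
    rw [mul_assoc, Finset.sum_mul]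
    gcongr with p hp
    refine (hD p ε x hx).trans ?_
    gcongr
    · exact hD0 p
    · exact Finset.le_sup (f := Prod.snd) hp
  | succ j ih =>
    let b := EuclideanSpace.basisFun (Fin n) ℝ
    choose C a hC0 hC using fun i : Fin n => ih (∂_{b i} φ)
    let S : Fin n → ℂ →L[ℝ] (Rn n →L[ℝ] ℂ) := fun i =>
      ContinuousLinearMap.smulRightL ℝ (Rn n) ℂ (EuclideanSpace.proj i)
    refine ⟨∑ i, ‖S i‖ * C i, Finset.univ.sup a + 1,
      Finset.sum_nonneg fun i _ => mul_nonneg (S i).opNorm_nonneg (hC0 i), fun ε x hx => ?_⟩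
    have hε : 0 < (ε : ℝ) := ε.2.1
    have hε1 : 1 ≤ (ε : ℝ)⁻¹ := (one_le_inv₀ ε.2.1).2 ε.2.2
    have hcd : ∀ i, ContDiff ℝ j
        ((((ε : ℝ) : ℂ))⁻¹ • conv T (dilate (∂_{b i} φ : 𝓢(Rn n, ℂ)) ε)) :=
      fun i => contDiff_const.smul (contDiff_infty.1 (contDiff_conv T _) j)
    have hf : fderiv ℝ (conv T (dilate φ ε)) = fun z => ∑ i,
        (S i ∘ ((((ε : ℝ) : ℂ))⁻¹ • conv T (dilate (∂_{b i} φ : 𝓢(Rn n, ℂ)) ε))) z := by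
      funext z
      rw [(hasFDerivAt_conv T _ z).fderiv]
      ext v
      have hv : v = ∑ i, v i • b i := by
        conv_lhs => rw [← b.sum_repr v]
        simp [b]
      conv_lhs => rw [hv]
      rw [map_sum, sum_apply]
      refine Finset.sum_congr rfl fun i _ => ?_
      rw [map_smul, convDeriv_apply, lineDeriv_dilate, conv_smul]
      simp [S]
    rw [← norm_iteratedFDeriv_fderiv, hf, iteratedFDeriv_fun_sum_apply
      fun i _ => ((S i).contDiff.comp (hcd i)).contDiffAt, Finset.sum_mul]
    refine norm_sum_le_of_le _ fun i _ => ?_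
    refine ((S i).norm_iteratedFDeriv_comp_left (hcd i).contDiffAt le_rfl).trans ?_
    rw [mul_assoc]
    gcongr
    rw [iteratedFDeriv_const_smul_apply (contDiff_infty.1 (contDiff_conv T _) j).contDiffAt,
      norm_smul, norm_inv, Complex.norm_real, Real.norm_of_nonneg hε.le]
    calc (ε : ℝ)⁻¹ * ‖iteratedFDeriv ℝ j (conv T (dilate (∂_{b i} φ : 𝓢(Rn n, ℂ)) ε)) x‖
        ≤ (ε : ℝ)⁻¹ * (C i * ((ε : ℝ)⁻¹) ^ a i) := by
          gcongr
          exact hC i ε x hx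
      _ ≤ (ε : ℝ)⁻¹ * (C i * ((ε : ℝ)⁻¹) ^ (Finset.univ.sup a)) := by
          gcongr
          · exact hC0 i
          · exact Finset.le_sup (Finset.mem_univ i)
      _ = C i * ((ε : ℝ)⁻¹) ^ (Finset.univ.sup a + 1) := by ring

/-- The restriction to `Ω̄` of a smooth function on `ℝⁿ`. -/
def restrictSmooth (Ω : Opens (Rn n)) (g : Rn n → ℂ) (hg : ContDiff ℝ ∞ g) : SmoothClosure Ω :=
  ⟨fun x => g x, hg.contDiffOn.congr (zeroExt_eqOn fun _ => rfl)⟩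

variable {Ω : Opens (Rn n)}

/-- The net `((T * φ_ε)|_Ω̄)_ε`. -/
def convNet (Ω : Opens (Rn n)) (φ : 𝓢(Rn n, ℂ)) (T : 𝓢'(Rn n, ℂ)) : I01 → SmoothClosure Ω :=
  fun ε => restrictSmooth Ω (conv T (dilate φ ε)) (contDiff_conv T _)

theorem convNet_mem (hΩ : Bornology.IsBounded (Ω : Set (Rn n))) (φ : 𝓢(Rn n, ℂ))
    (T : 𝓢'(Rn n, ℂ)) : convNet Ω φ T ∈ Moderate Ω := by
  intro k
  obtain ⟨R, hR0, hR⟩ := hΩ.exists_pos_norm_le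
  choose C a hC0 hC using fun j : ℕ => iteratedFDeriv_conv_dilate_le T R hR0.le j φ
  refine ⟨-(((Finset.range (k + 1)).sup a : ℕ) : ℝ), (∑ j ∈ Finset.range (k + 1), C j).toNNReal,
    1, one_pos, fun ε _ => mu_le fun j hj x hx => ?_⟩
  have hε1 : 1 ≤ (ε : ℝ)⁻¹ := (one_le_inv₀ ε.2.1).2 ε.2.2
  have e : zeroExt (convNet Ω φ T ε).1 =ᶠ[𝓝 x] conv T (dilate φ ε) :=
    zeroExt_eventuallyEq (g := conv T (dilate φ ε)) (fun _ => rfl) hx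
  rw [(e.iteratedFDeriv ℝ j).eq_of_nhds, ← ofReal_norm]
  change _ ≤ ENNReal.ofReal (∑ j ∈ Finset.range (k + 1), C j) * _
  rw [← ENNReal.ofReal_mul (Finset.sum_nonneg fun j _ => hC0 j)]
  refine ENNReal.ofReal_le_ofReal ((hC j ε x (hR x hx)).trans ?_)
  rw [Real.rpow_neg ε.2.1.le, Real.rpow_natCast, ← inv_pow]
  have hjk := Finset.mem_range_succ_iff.2 hj
  gcongr
  · exact Finset.sum_nonneg fun j _ => hC0 j
  · exact Finset.single_le_sum (fun j _ => hC0 j) hjk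
  · exact Finset.le_sup hjk

/-- The linear map `T ↦ [((T * φ_ε)|_Ω̄)_ε]` from tempered distributions to `𝒢(Ω̄)`. -/
def mollify (hΩ : Bornology.IsBounded (Ω : Set (Rn n))) (φ : 𝓢(Rn n, ℂ)) :
    𝓢'(Rn n, ℂ) →ₗ[ℂ] GenFun Ω :=
  (Ideal.Quotient.mkₐ ℂ (Null Ω)).toLinearMap ∘ₗ
    { toFun := fun T => (⟨convNet Ω φ T, convNet_mem hΩ φ T⟩ : Moderate Ω)
      map_add' := fun _ _ => rfl
      map_smul' := fun _ _ => rfl }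

end Convolution

section Distributions

/-- A real test function on `U`, viewed as a Schwartz function on `ℝⁿ`. -/
def testToSchwartz {U : Opens (Rn n)} (χ : 𝓓(U, ℝ)) : 𝓢(Rn n, ℂ) :=
  (χ.hasCompactSupport.comp_left (g := ((↑) : ℝ → ℂ)) Complex.ofReal_zero).toSchwartzMap
    (Complex.ofRealCLM.contDiff.comp χ.contDiff)

theorem testToSchwartz_apply {U : Opens (Rn n)} (χ : 𝓓(U, ℝ)) (x : Rn n) :
    testToSchwartz χ x = (χ x : ℂ) := rfl

theorem continuous_testToSchwartz (U : Opens (Rn n)) :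
    Continuous (testToSchwartz : 𝓓(U, ℝ) → 𝓢(Rn n, ℂ)) := by
  let L : 𝓓(U, ℝ) →ₗ[ℝ] 𝓢(Rn n, ℂ) :=
    { toFun := testToSchwartz
      map_add' := fun χ χ' => by ext x; simp [testToSchwartz_apply]
      map_smul' := fun c χ => by ext x; simp [testToSchwartz_apply] }
  refine (TestFunction.continuous_iff_continuous_comp L).2 fun K hK => ?_
  let LK : 𝓓_{K}(Rn n, ℝ) →ₗ[ℝ] 𝓢(Rn n, ℂ) :=
    L ∘ₗ (TestFunction.ofSupportedInCLM ℝ hK).toLinearMap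
  obtain ⟨R, hR0, hR⟩ := K.isCompact.isBounded.exists_pos_norm_le
  refine WithSeminorms.continuous_of_isBounded
    (ContDiffMapSupportedIn.withSeminorms ℝ (Rn n) ℝ ⊤ K)
    (schwartz_withSeminorms ℝ (Rn n) ℂ) LK fun p => ?_
  refine ⟨{p.2}, ⟨R ^ p.1, by positivity⟩, fun f => ?_⟩
  refine SchwartzMap.seminorm_le_bound ℝ p.1 p.2 _ (by positivity) fun x => ?_
  have e : (LK f : Rn n → ℂ) = Complex.ofRealLI ∘ f := rfl
  rw [e, LinearIsometry.norm_iteratedFDeriv_comp_left _ (f.contDiff.of_le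
    (by exact_mod_cast le_top)).contDiffAt (n := p.2) le_rfl]
  change _ ≤ R ^ p.1 * (({p.2} : Finset ℕ).sup
    (ContDiffMapSupportedIn.seminorm ℝ (Rn n) ℝ ⊤ K)) f
  rw [Finset.sup_singleton]
  by_cases hx : x ∈ K
  · gcongr
    · exact hR x hx
    · exact ContDiffMapSupportedIn.norm_iteratedFDeriv_apply_le_seminorm_top ℝ
  · rw [f.iteratedFDeriv_zero_on_compl hx]
    simp only [Pi.zero_apply, norm_zero, mul_zero]
    positivity

/-- The restriction to `𝓓(U)` of a tempered distribution on `ℝⁿ`. -/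
def restrict (U : Opens (Rn n)) (T : 𝓢'(Rn n, ℂ)) : 𝓓'(U, ℂ) where
  toFun χ := T (testToSchwartz χ)
  map_add' χ χ' := by
    rw [← map_add]; congr 1; ext x; simp [testToSchwartz_apply]
  map_smul' c χ := by
    have : testToSchwartz (c • χ) = (c : ℂ) • testToSchwartz χ := by
      ext x; simp [testToSchwartz_apply]
    rw [this, map_smul]; simp
  cont := (map_continuous T).comp (continuous_testToSchwartz U)

/-- The distribution `χ ↦ ∫ χ g` on `U` defined by a locally integrable function `g`. -/
def ofFun (U : Opens (Rn n)) (g : Rn n → ℂ) : 𝓓'(U, ℂ) :=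
  TestFunction.integralAgainstBilinCLM (ContinuousLinearMap.lsmul ℝ ℝ) volume g

/-- The `L^p(U)` norm of a distribution: `‖g‖_p` if `T` is a function `g ∈ L^p(U)`, and `∞` if `T`
is not a function in `L^p(U)`. -/
def lpNorm (p : ℝ≥0∞) {U : Opens (Rn n)} (T : 𝓓'(U, ℂ)) : ℝ≥0∞ :=
  ⨅ (g : Rn n → ℂ) (_ : MemLp g p (volume.restrict U)) (_ : T = ofFun U g),
    eLpNorm g p (volume.restrict U)

/-- The norm of `W^{k,p}(U)`: the sum of the `L^p` norms of the distributional derivatives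
`∂_{i₁} ⋯ ∂_{i_j} T` of order `j ≤ k` (each `D^α` is counted once per ordering of its factors,
which gives an equivalent norm). It is `∞` exactly if `T ∉ W^{k,p}(U)`. -/
def sobolevNorm (k : ℕ) (p : ℝ≥0∞) {U : Opens (Rn n)} (T : 𝓓'(U, ℂ)) : ℝ≥0∞ :=
  ∑ j ∈ Finset.range (k + 1), ∑ i : Fin j → Fin n,
    lpNorm p (∂^{fun s => EuclideanSpace.single (i s) (1 : ℝ)} T)

/-- `T ∈ W^{k,p}(U)` for `0 ≤ k ≤ ∞`. -/
def MemSobolev (k : ℕ∞) (p : ℝ≥0∞) {U : Opens (Rn n)} (T : 𝓓'(U, ℂ)) : Prop :=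
  ∀ m : ℕ, (m : ℕ∞) ≤ k → sobolevNorm m p T < ⊤

/-- `T ∈ ℰ'(Ω')` for an open `Ω' ⊆ Ω`: the distribution `T` on `Ω` has compact support contained
in `Ω'`. -/
def MemCompactSupport {Ω : Opens (Rn n)} (Ω' : Opens (Rn n)) (T : 𝓓'(Ω, ℂ)) : Prop :=
  IsCompact (Distribution.dsupport T) ∧ Distribution.dsupport T ⊆ Ω'

/-- The space `ℱ'(Ω) = ℰ'(Ω') + ⋃_{k,p} W^{k,p}(Ω)`, with `0 ≤ k ≤ ∞` and `1 ≤ p ≤ ∞`. -/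
def DistSpace (Ω Ω' : Opens (Rn n)) : Submodule ℂ 𝓓'(Ω, ℂ) :=
  Submodule.span ℂ
    ({T | MemCompactSupport Ω' T} ∪ {T | ∃ (k : ℕ∞) (p : ℝ≥0∞), 1 ≤ p ∧ MemSobolev k p T})

/-- `E` is a total extension operator for `Ω`, extended to `ℰ'(Ω')`: a linear map that assigns to
every `u ∈ ℱ'(Ω)` a distribution on `ℝⁿ` whose restriction to `Ω` is `u`, that is bounded from
`W^{k,p}(Ω)` to `W^{k,p}(ℝⁿ)` for all `k` and `p`, and that extends the elements of `ℰ'(Ω')` by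
zero. (All distributions in its range are tempered: they are sums of `L^p` functions on `ℝⁿ` and of
compactly supported distributions.) -/
structure IsTotalExtension {Ω Ω' : Opens (Rn n)} (E : DistSpace Ω Ω' →ₗ[ℂ] 𝓢'(Rn n, ℂ)) :
    Prop where
  restrict_eq : ∀ u : DistSpace Ω Ω', restrict Ω (E u) = u
  sobolev_bound : ∀ (k : ℕ) (p : ℝ≥0∞), 1 ≤ p → ∃ C : ℝ≥0, ∀ u : DistSpace Ω Ω',
    MemSobolev k p (u : 𝓓'(Ω, ℂ)) →
      sobolevNorm k p (restrict ⊤ (E u)) ≤ C * sobolevNorm k p (u : 𝓓'(Ω, ℂ))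
  zero_outside : ∀ u : DistSpace Ω Ω', MemCompactSupport Ω' (u : 𝓓'(Ω, ℂ)) →
    Distribution.dsupport (E u) ⊆ Ω

/-- The embedding `i : ℱ'(Ω) → 𝒢(Ω̄)`, `i(u) = (E(u) * φ_ε)|_Ω̄ + 𝒩(Ω̄)`. -/
def embedding {Ω Ω' : Opens (Rn n)} (hΩ : Bornology.IsBounded (Ω : Set (Rn n)))
    (E : DistSpace Ω Ω' →ₗ[ℂ] 𝓢'(Rn n, ℂ)) (φ : 𝓢(Rn n, ℂ)) : DistSpace Ω Ω' →ₗ[ℂ] GenFun Ω :=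
  mollify hΩ φ ∘ₗ E

theorem ofFun_mem {Ω : Opens (Rn n)} (Ω' : Opens (Rn n))
    (hΩ : Bornology.IsBounded (Ω : Set (Rn n))) (f : SmoothClosure Ω) :
    ofFun Ω (zeroExt f.1) ∈ DistSpace Ω Ω' := by
  refine Submodule.subset_span (Or.inr ⟨0, ⊤, le_top, fun m hm => ?_⟩)
  obtain rfl : m = 0 := by simpa using hm
  have hb : MemLp (zeroExt f.1) ⊤ (volume.restrict (Ω : Set (Rn n))) := by
    have h0 := mu_lt_top hΩ 0 f
    refine memLp_top_of_bound ?_ (mu 0 f).toReal ?_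
    · exact ((f.2.mono subset_closure).continuousOn).aestronglyMeasurable Ω.isOpen.measurableSet
    · refine (ae_restrict_iff' Ω.isOpen.measurableSet).2 (Filter.Eventually.of_forall fun x hx => ?_)
      have := ENNReal.toReal_mono h0.ne (enorm_le_mu f le_rfl hx)
      rwa [toReal_enorm, norm_iteratedFDeriv_zero] at this
  simp only [sobolevNorm, zero_add, Finset.range_one, Finset.sum_singleton]
  refine ENNReal.sum_lt_top.2 fun i _ => ?_
  rw [LineDeriv.iteratedLineDerivOp_fin_zero]
  refine lt_of_le_of_lt (iInf_le_of_le (zeroExt f.1) (iInf_le_of_le hb (iInf_le _ rfl))) hb.2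

/-- The inclusion `C^∞(Ω̄) ⊆ ℱ'(Ω)`. -/
def ofSmooth {Ω : Opens (Rn n)} (Ω' : Opens (Rn n))
    (hΩ : Bornology.IsBounded (Ω : Set (Rn n))) (f : SmoothClosure Ω) : DistSpace Ω Ω' :=
  ⟨ofFun Ω (zeroExt f.1), ofFun_mem Ω' hΩ f⟩

end Distributions
end Colombeau

end

noncomputable section

namespace Colombeau

variable {n : ℕ}

/-! Put `T = E f` and `φ = 𝓕⁻ ψ`. Since `f` is smooth up to the boundary of a bounded set, all its
derivatives are bounded, so `f` lies in `W^{k,∞}(Ω)` for every finite `k`; boundedness of `E` on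
these spaces makes every partial derivative of `T` an `L^∞` function on the whole space
(`IsTotalExtension.boundedDerivs`). It remains to see that `T * φ_ε - f` and all its derivatives are
`O(ε^m)` uniformly on `Ω`, for every `m`.

The classical argument is Taylor expansion against the vanishing moments of `φ`. Here the moments
are used on the Fourier side. The kernel `κ = φ - φ_{1/2}` has Fourier transform `ψ(ξ) - ψ(ξ/2)`,
which vanishes near `0`. Hence `κ` can be divided by the symbol of the Laplacian any number of
times: `κ = Δ^m κ_m` with `κ_m` Schwartz (`exists_laplacian_eq`). Moving derivatives from a dilated
kernel to `T` gains a factor `ε` each, so `T * κ_ε = ε^{2m} (Δ^m T) * (κ_m)_ε`, and the last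
convolution is bounded uniformly in `ε` and `x` (`BoundedDerivs.conv_dilate_le`).

The differences `T * φ_{ε/2^j} - T * φ_{ε/2^{j+1}}` are `T * κ_{ε/2^j}`, so they sum geometrically;
as `j → ∞` the convolutions tend to `f` at each point of `Ω`, because `∫ φ = ψ 0 = 1` and `T = f`
there (`tendsto_conv_dilate`). Telescoping gives the rate (`BoundedDerivs.norm_conv_dilate_sub_le`).
For derivatives, the same estimate applies to `∂^α T`, which again has bounded derivatives and
equals `∂^α f` on `Ω`. Multiplicativity follows because `σ` is an algebra homomorphism. -/

theorem contDiff_of_contDiffAt_tsupport {E F : Type*} [NormedAddCommGroup E] [NormedSpace ℝ E]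
    [NormedAddCommGroup F] [NormedSpace ℝ F] {m : WithTop ℕ∞} {f : E → F}
    (h : ∀ x ∈ tsupport f, ContDiffAt ℝ m f x) : ContDiff ℝ m f := by
  refine contDiff_iff_contDiffAt.2 fun x => ?_
  by_cases hx : x ∈ tsupport f
  · exact h x hx
  · exact contDiffAt_const.congr_of_eventuallyEq (notMem_tsupport_iff_eventuallyEq.1 hx)

/-! ### Inverting the Laplacian away from frequency zero -/

/-- A function of temperate growth that agrees with `1 / ‖ξ‖²` away from the origin. -/
theorem exists_hasTemperateGrowth_norm_sq_mul_eq_one {r : ℝ} (hr : 0 < r) :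
    ∃ ρ : Rn n → ℝ, ρ.HasTemperateGrowth ∧ ∀ ξ, r ≤ ‖ξ‖ → ‖ξ‖ ^ 2 * ρ ξ = 1 := by
  have h1 : (1 + r ^ 2)⁻¹ < 1 := inv_lt_one_of_one_lt₀ (by nlinarith)
  obtain ⟨c, hc, hc1⟩ := exists_between h1
  let b : ContDiffBump (0 : ℝ) := ⟨(1 + r ^ 2)⁻¹, c, by positivity, hc⟩
  -- At `t = (1 + ‖ξ‖²)⁻¹` the quotient `t / (1 - t)` equals `1 / ‖ξ‖²`. The frequencies `‖ξ‖ ≥ r`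
  -- correspond to `t ≤ (1 + r²)⁻¹`, where the bump is `1`; its support stops at `c < 1`, before the
  -- pole `t = 1`, i.e. `ξ = 0`. Temperate growth then follows by composition.
  let h : ℝ → ℝ := fun t => b t * (t / (1 - t))
  have hts : tsupport h ⊆ Metric.closedBall 0 c :=
    (tsupport_mul_subset_left).trans b.tsupport_eq.subset
  have hsm : ContDiff ℝ ∞ h := by
    refine contDiff_of_contDiffAt_tsupport fun t ht => ?_
    have ht' : t ≤ c := (le_abs_self t).trans (by simpa using hts ht)
    refine b.contDiffAt.mul (contDiffAt_id.div (contDiffAt_const.sub contDiffAt_id) ?_)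
    linarith
  have hcs : HasCompactSupport h := b.hasCompactSupport.mul_right
  refine ⟨h ∘ fun ξ => (1 + ‖ξ‖ ^ 2) ^ (-1 : ℝ), (hcs.hasTemperateGrowth hsm).comp
    (Function.hasTemperateGrowth_one_add_norm_sq_rpow _ _), fun ξ hξ => ?_⟩
  have hξ0 : 0 < ‖ξ‖ := hr.trans_le hξ
  have hb : b ((1 + ‖ξ‖ ^ 2)⁻¹) = 1 := by
    apply b.one_of_mem_closedBall
    rw [mem_closedBall_zero_iff, Real.norm_of_nonneg (by positivity)]
    change _ ≤ (1 + r ^ 2)⁻¹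
    gcongr
  simp only [Function.comp, Real.rpow_neg_one, h, hb]
  have : 1 + ‖ξ‖ ^ 2 ≠ 0 := by positivity
  have h2 : 1 - (1 + ‖ξ‖ ^ 2)⁻¹ = ‖ξ‖ ^ 2 / (1 + ‖ξ‖ ^ 2) := by field_simp; ring
  rw [h2]
  field_simp

open Laplacian Real in
/-- A Schwartz function whose Fourier transform vanishes near the origin is the Laplacian of another
such function. -/
theorem exists_laplacian_eq (κ : 𝓢(Rn n, ℂ)) (hκ : ∀ᶠ ξ in 𝓝 0, 𝓕 κ ξ = 0) :
    ∃ κ' : 𝓢(Rn n, ℂ), (∀ᶠ ξ in 𝓝 0, 𝓕 κ' ξ = 0) ∧ κ = Δ κ' := by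
  obtain ⟨r, hr, hκr⟩ := Metric.eventually_nhds_iff.1 hκ
  obtain ⟨ρ, hρ, hρ1⟩ := exists_hasTemperateGrowth_norm_sq_mul_eq_one (n := n) hr
  have hn : (fun ξ : Rn n => ‖ξ‖ ^ 2).HasTemperateGrowth := by fun_prop
  -- The symbol of `Δ` is `-(2π)² ‖ξ‖²`; the witness divides `𝓕 κ` by it.
  refine ⟨(-(2 * π) ^ 2)⁻¹ • SchwartzMap.fourierMultiplierCLM ℂ ρ κ, ?_, ?_⟩
  · filter_upwards [hκ] with ξ hξ
    rw [FourierTransform.fourier_smul, SchwartzMap.fourierMultiplierCLM_apply,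
      FourierTransform.fourier_fourierInv_eq, smul_apply,
      SchwartzMap.smulLeftCLM_apply_apply hρ, hξ, smul_zero, smul_zero]
  · rw [SchwartzMap.laplacian_eq_fourierMultiplierCLM, map_smul, smul_smul, mul_inv_cancel₀
      (neg_ne_zero.2 (by positivity)), one_smul]
    have := SchwartzMap.fourierMultiplierCLM_fourierMultiplierCLM_apply hn hρ κ
    refine Eq.trans ?_ this.symm
    rw [SchwartzMap.fourierMultiplierCLM_apply]
    have e : SchwartzMap.smulLeftCLM ℂ ((fun ξ : Rn n => ‖ξ‖ ^ 2) * ρ) (𝓕 κ) = 𝓕 κ := by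
      ext ξ
      rw [SchwartzMap.smulLeftCLM_apply_apply (hn.mul hρ)]
      -- For `‖ξ‖ < r` the value of `ρ` is irrelevant, since `𝓕 κ` vanishes there.
      by_cases h : r ≤ ‖ξ‖
      · rw [Pi.mul_apply, hρ1 ξ h, one_smul]
      · rw [hκr (by simpa using h), smul_zero]
    rw [e, FourierTransform.fourierInv_fourier_eq]

/-! ### Convolution with dilated kernels -/

theorem conv_sum {ι : Type*} (T : 𝓢'(Rn n, ℂ)) (s : Finset ι) (φ : ι → 𝓢(Rn n, ℂ)) (x : Rn n) :
    conv T (∑ i ∈ s, φ i) x = ∑ i ∈ s, conv T (φ i) x := by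
  simp [conv, reflectAt, map_sum]

theorem conv_sub (T : 𝓢'(Rn n, ℂ)) (φ χ : 𝓢(Rn n, ℂ)) (x : Rn n) :
    conv T (φ - χ) x = conv T φ x - conv T χ x := by
  simp [conv, reflectAt]

theorem dilate_sum {ι : Type*} (s : Finset ι) (φ : ι → 𝓢(Rn n, ℂ)) (ε : I01) :
    dilate (∑ i ∈ s, φ i) ε = ∑ i ∈ s, dilate (φ i) ε := by
  simp [dilate, map_sum, Finset.smul_sum]

theorem dilate_sub (φ χ : 𝓢(Rn n, ℂ)) (ε : I01) :
    dilate (φ - χ) ε = dilate φ ε - dilate χ ε := by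
  simp [dilate, smul_sub]

theorem conv_lineDeriv (T : 𝓢'(Rn n, ℂ)) (φ : 𝓢(Rn n, ℂ)) (h x : Rn n) :
    conv T (∂_{h} φ : 𝓢(Rn n, ℂ)) x = conv (∂_{h} T) φ x := by
  rw [conv, conv, TemperedDistribution.lineDerivOp_apply_apply, ← lineDeriv_reflectAt,
    LineDeriv.lineDerivOp_left_neg]

/-- Differentiating `φ_ε` costs `ε⁻¹`, so a derivative taken before dilation and then moved to `T`
gains `ε`. All powers of `ε` in the decay estimate come from here. -/
theorem conv_dilate_lineDeriv (T : 𝓢'(Rn n, ℂ)) (φ : 𝓢(Rn n, ℂ)) (ε : I01) (h x : Rn n) :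
    conv T (dilate (∂_{h} φ : 𝓢(Rn n, ℂ)) ε) x = (ε : ℝ) * conv (∂_{h} T) (dilate φ ε) x := by
  have hε : ((ε : ℝ) : ℂ) ≠ 0 := by exact_mod_cast ε.2.1.ne'
  rw [← conv_lineDeriv, lineDeriv_dilate, conv_smul, mul_inv_cancel_left₀ hε]

theorem quasiMeasurePreserving_sub_smul (x : Rn n) {ε : ℝ} (hε : ε ≠ 0) :
    Measure.QuasiMeasurePreserving (fun y : Rn n => x - ε • y) volume volume := by
  refine (Measure.measurePreserving_sub_left volume x).quasiMeasurePreserving.comp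
    (⟨by fun_prop, ?_⟩ : Measure.QuasiMeasurePreserving (fun y : Rn n => ε • y) volume volume)
  rw [Measure.map_addHaar_smul volume hε]
  exact Measure.smul_absolutelyContinuous

/-- The substitution `y ↦ (x - y) / ε` moves `ε` from the kernel into the argument of `g`, so that
`‖g‖ ‖φ y‖` is an integrable majorant independent of `ε` and `x`. -/
theorem conv_dilate_eq_integral (g : Lp ℂ ⊤ (volume : Measure (Rn n))) (φ : 𝓢(Rn n, ℂ)) (ε : I01)
    (x : Rn n) : conv (Lp.toTemperedDistribution g) (dilate φ ε) x =
      ∫ y, φ y * g (x - (ε : ℝ) • y) := by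
  have hε : 0 < (ε : ℝ) := ε.2.1
  have hε' : (((ε : ℝ) : ℂ) ^ n) ≠ 0 := pow_ne_zero _ (by exact_mod_cast hε.ne')
  let G : Rn n → ℂ := fun y => φ y * g (x - (ε : ℝ) • y)
  have h1 := Measure.integral_comp_smul (volume : Measure (Rn n)) G (ε : ℝ)⁻¹
  have h2 := integral_sub_left_eq_self (μ := (volume : Measure (Rn n)))
    (fun y => φ ((ε : ℝ)⁻¹ • (x - y)) * g y) x
  simp only [sub_sub_cancel] at h2
  rw [conv, Lp.toTemperedDistribution_apply]
  simp only [reflectAt_apply, dilate_apply, smul_eq_mul, mul_assoc]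
  rw [integral_const_mul, ← h2]
  have h3 : (fun y => G ((ε : ℝ)⁻¹ • y)) = fun y => φ ((ε : ℝ)⁻¹ • y) * g (x - y) := by
    funext y
    simp only [G, smul_inv_smul₀ hε.ne']
  rw [h3] at h1
  rw [h1, abs_of_pos (by positivity)]
  simp only [inv_pow, inv_inv, finrank_euclideanSpace, Fintype.card_fin, Complex.real_smul,
    Complex.ofReal_pow]
  rw [inv_mul_cancel_left₀ hε']

theorem ae_norm_le_Lp_top (g : Lp ℂ ⊤ (volume : Measure (Rn n))) : ∀ᵐ y, ‖g y‖ ≤ ‖g‖ := by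
  filter_upwards [ae_le_eLpNormEssSup (f := g) (μ := (volume : Measure (Rn n)))] with y hy
  rw [Lp.norm_def, eLpNorm_exponent_top, ← toReal_enorm]
  refine ENNReal.toReal_mono ?_ hy
  rw [← eLpNorm_exponent_top]
  exact Lp.eLpNorm_ne_top g

theorem ae_norm_mul_comp_le (g : Lp ℂ ⊤ (volume : Measure (Rn n))) (φ : 𝓢(Rn n, ℂ)) (ε : I01)
    (x : Rn n) : ∀ᵐ y, ‖φ y * g (x - (ε : ℝ) • y)‖ ≤ ‖g‖ * ‖φ y‖ := by
  filter_upwards [(quasiMeasurePreserving_sub_smul x ε.2.1.ne').ae (ae_norm_le_Lp_top g)] with y hy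
  rw [norm_mul, mul_comm]
  gcongr

theorem norm_conv_dilate_le (g : Lp ℂ ⊤ (volume : Measure (Rn n))) (φ : 𝓢(Rn n, ℂ)) (ε : I01)
    (x : Rn n) : ‖conv (Lp.toTemperedDistribution g) (dilate φ ε) x‖ ≤ ‖g‖ * ∫ y, ‖φ y‖ := by
  rw [conv_dilate_eq_integral, ← integral_const_mul]
  exact norm_integral_le_of_norm_le (φ.integrable.norm.const_mul _) (ae_norm_mul_comp_le g φ ε x)

/-! ### Rapid decay for kernels with no low frequencies -/

/-- The tempered distributions all of whose partial derivatives are bounded functions. -/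
def BoundedDerivs (S : 𝓢'(Rn n, ℂ)) : Prop :=
  ∀ (j : ℕ) (i : Fin j → Fin n), ∃ g : Lp ℂ ⊤ (volume : Measure (Rn n)),
    ∂^{fun s => EuclideanSpace.single (i s) (1 : ℝ)} S = Lp.toTemperedDistribution g

theorem BoundedDerivs.lineDeriv {S : 𝓢'(Rn n, ℂ)} (hS : BoundedDerivs S) (i : Fin n) :
    BoundedDerivs (∂_{EuclideanSpace.single i (1 : ℝ)} S) := fun j s => by
  -- The last index of an iterated derivative acts first on `S`, so appending `i` at the end avoids
  -- commuting derivatives.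
  obtain ⟨g, hg⟩ := hS (j + 1) (Fin.snoc s i)
  refine ⟨g, ?_⟩
  rw [← hg, LineDeriv.iteratedLineDerivOp_succ_right]
  simp [Fin.init_def]

/-- Convolution with dilates of a kernel all of whose moments vanish decays rapidly. -/
theorem BoundedDerivs.conv_dilate_le (m : ℕ) {S : 𝓢'(Rn n, ℂ)} (hS : BoundedDerivs S)
    (κ : 𝓢(Rn n, ℂ)) (hκ : ∀ᶠ ξ in 𝓝 0, 𝓕 κ ξ = 0) :
    ∃ C : ℝ, ∀ (ε : I01) (x : Rn n), ‖conv S (dilate κ ε) x‖ ≤ C * (ε : ℝ) ^ m := by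
  induction m generalizing S κ with
  | zero =>
    obtain ⟨g, hg⟩ := hS 0 Fin.elim0
    rw [LineDeriv.iteratedLineDerivOp_fin_zero] at hg
    subst hg
    exact ⟨‖g‖ * ∫ y, ‖κ y‖, fun ε x => by simpa using norm_conv_dilate_le g κ ε x⟩
  | succ m ih =>
    -- The new kernel satisfies the same spectral hypothesis and `∂_i ∂_i S` again has bounded
    -- derivatives, so the induction can continue.
    obtain ⟨κ', hκ', rfl⟩ := exists_laplacian_eq κ hκ
    choose C hC using fun i : Fin n => ih ((hS.lineDeriv i).lineDeriv i) κ' hκ'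
    refine ⟨∑ i, C i, fun ε x => ?_⟩
    have hε : 0 < (ε : ℝ) := ε.2.1
    rw [SchwartzMap.laplacian_eq_sum (EuclideanSpace.basisFun (Fin n) ℝ), dilate_sum, conv_sum,
      Finset.sum_mul]
    refine norm_sum_le_of_le _ fun i _ => ?_
    rw [EuclideanSpace.basisFun_apply, conv_dilate_lineDeriv, conv_dilate_lineDeriv, norm_mul,
      norm_mul, Complex.norm_real, Real.norm_of_nonneg hε.le]
    have h := hC i ε x
    have h0 : 0 ≤ C i * (ε : ℝ) ^ m := (norm_nonneg _).trans h
    -- The Laplacian yields `ε²`; one factor is enough for the induction, and the other is bounded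
    -- by `1`.
    calc (ε : ℝ) * (ε * ‖_‖) ≤ ε * (1 * (C i * (ε : ℝ) ^ m)) := by
          gcongr
          exact ε.2.2
      _ = C i * (ε : ℝ) ^ (m + 1) := by ring

/-! ### Dyadic telescoping and convergence of the mollification -/

/-- The dyadic sequence `ε / 2 ^ j`. -/
def dyadic (ε : I01) (j : ℕ) : I01 :=
  ⟨ε / 2 ^ j, div_pos ε.2.1 (by positivity),
    (div_le_self ε.2.1.le (one_le_pow₀ one_le_two)).trans ε.2.2⟩

theorem coe_dyadic (ε : I01) (j : ℕ) : (dyadic ε j : ℝ) = ε / 2 ^ j := rfl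

/-- Dilations compose. With the halving (`dyadic 1 1` is `1/2`) innermost, consecutive dyadic
mollifiers differ by dilates of the single kernel `φ - φ_{1/2}`. -/
theorem dilate_dyadic_succ (φ : 𝓢(Rn n, ℂ)) (ε : I01) (j : ℕ) :
    dilate φ (dyadic ε (j + 1)) = dilate (dilate φ (dyadic 1 1)) (dyadic ε j) := by
  ext x
  have hε : ((ε : ℝ) : ℂ) ≠ 0 := by exact_mod_cast ε.2.1.ne'
  simp only [dilate_apply, coe_dyadic, smul_smul, ← mul_assoc]
  congr 1
  · push_cast
    rw [← mul_inv, ← mul_pow]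
    congr 2
    rw [pow_succ]
    ring
  · congr 2
    simp [pow_succ]
    ring

theorem fourier_dilate (φ : 𝓢(Rn n, ℂ)) (ε : I01) (ξ : Rn n) :
    𝓕 (dilate φ ε) ξ = 𝓕 φ ((ε : ℝ) • ξ) := by
  have hε : 0 < (ε : ℝ) := ε.2.1
  have hε' : (((ε : ℝ) : ℂ) ^ n) ≠ 0 := pow_ne_zero _ (by exact_mod_cast hε.ne')
  rw [SchwartzMap.fourier_coe, SchwartzMap.fourier_coe, Real.fourier_eq, Real.fourier_eq]
  have h1 := Measure.integral_comp_smul (volume : Measure (Rn n))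
    (fun v => Real.fourierChar (-inner ℝ v ((ε : ℝ) • ξ)) • φ v) (ε : ℝ)⁻¹
  rw [abs_of_pos (by positivity)] at h1
  simp only [inv_pow, inv_inv, finrank_euclideanSpace, Fintype.card_fin, Complex.real_smul,
    Complex.ofReal_pow, inner_smul_left, inner_smul_right, map_inv₀, RCLike.conj_to_real,
    mul_inv_cancel_left₀ hε.ne'] at h1
  simp only [inner_smul_right]
  rw [← inv_mul_cancel_left₀ hε' (∫ v, Real.fourierChar (-((ε : ℝ) * inner ℝ v ξ)) • φ v), ← h1,
    ← integral_const_mul]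
  refine integral_congr_ae (Filter.Eventually.of_forall fun v => ?_)
  simp only [dilate_apply, Circle.smul_def, smul_eq_mul]
  ring

/-- The transform is `ψ(ξ) - ψ(εξ)`, and both terms are `1` near `0`. This is the only place where
`ψ = 1` on a whole neighbourhood, rather than just at `0`, matters. -/
theorem fourier_sub_dilate_eventually_eq_zero (ψ : 𝓢(Rn n, ℂ)) (hψ : ∀ᶠ ξ in 𝓝 0, ψ ξ = 1)
    (ε : I01) : ∀ᶠ ξ in 𝓝 0, 𝓕 (𝓕⁻ ψ - dilate (𝓕⁻ ψ) ε) ξ = 0 := by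
  have hc : Filter.Tendsto (fun ξ : Rn n => (ε : ℝ) • ξ) (𝓝 0) (𝓝 0) := by
    simpa using (continuous_const_smul (ε : ℝ)).tendsto (0 : Rn n)
  filter_upwards [hψ, hc.eventually hψ] with ξ h1 h2
  rw [sub_eq_add_neg, FourierTransform.fourier_add, FourierTransform.fourier_neg, ← sub_eq_add_neg,
    sub_apply, fourier_dilate,
    FourierTransform.fourier_fourierInv_eq, h1, h2, sub_self]

theorem integral_fourierInv (ψ : 𝓢(Rn n, ℂ)) : ∫ y, (𝓕⁻ ψ : 𝓢(Rn n, ℂ)) y = ψ 0 := by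
  conv_rhs => rw [← FourierTransform.fourier_fourierInv_eq (F := 𝓢(Rn n, ℂ)) ψ]
  rw [SchwartzMap.fourier_coe, Real.fourier_eq]
  simp

/-- Dominated convergence: for fixed `y` the point `x - e_j y` eventually lies in `Ω`, where `g`
agrees almost everywhere with the continuous `F`. Outside `Ω` only boundedness of `g` is needed. -/
theorem tendsto_conv_dilate (g : Lp ℂ ⊤ (volume : Measure (Rn n))) (φ : 𝓢(Rn n, ℂ))
    (hφ : ∫ y, φ y = 1) {Ω : Opens (Rn n)} {F : Rn n → ℂ}
    (hF : ContinuousOn F (Ω : Set (Rn n))) (hg : g =ᵐ[volume.restrict (Ω : Set (Rn n))] F)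
    {x : Rn n} (hx : x ∈ Ω) (e : ℕ → I01) (he : Filter.Tendsto (fun j => (e j : ℝ)) .atTop (𝓝 0)) :
    Filter.Tendsto (fun j => conv (Lp.toTemperedDistribution g) (dilate φ (e j)) x) .atTop
      (𝓝 (F x)) := by
  have hg' : ∀ᵐ y, y ∈ (Ω : Set (Rn n)) → g y = F y :=
    (ae_restrict_iff' Ω.isOpen.measurableSet).1 hg
  -- Working along a sequence leaves only countably many exceptional null sets.
  have hall : ∀ᵐ y, ∀ j, x - (e j : ℝ) • y ∈ (Ω : Set (Rn n)) →
      g (x - (e j : ℝ) • y) = F (x - (e j : ℝ) • y) :=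
    ae_all_iff.2 fun j => (quasiMeasurePreserving_sub_smul x (e j).2.1.ne').ae hg'
  have h1 : F x = ∫ y, φ y * F x := by rw [integral_mul_const, hφ, one_mul]
  rw [h1]
  simp only [conv_dilate_eq_integral]
  refine tendsto_integral_of_dominated_convergence (fun y => ‖g‖ * ‖φ y‖) (fun j => ?_)
    (φ.integrable.norm.const_mul _) (fun j => ae_norm_mul_comp_le g φ (e j) x) ?_
  · exact φ.continuous.aestronglyMeasurable.mul ((Lp.aestronglyMeasurable g).comp_quasiMeasurePreserving
      (quasiMeasurePreserving_sub_smul x (e j).2.1.ne'))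
  · filter_upwards [hall] with y hy
    have ht : Filter.Tendsto (fun j => x - (e j : ℝ) • y) .atTop (𝓝 x) := by
      simpa using tendsto_const_nhds.sub (he.smul_const y)
    have hc := ((hF.continuousAt (Ω.isOpen.mem_nhds hx)).tendsto.comp ht).const_mul (φ y)
    refine hc.congr' ?_
    filter_upwards [ht.eventually (Ω.isOpen.mem_nhds hx)] with j hj
    rw [hy j hj]
    rfl

/-- Mollification by `𝓕⁻ ψ` converges faster than any power of `ε` where the distribution is
continuous. -/
theorem BoundedDerivs.norm_conv_dilate_sub_le (m : ℕ) (ψ : 𝓢(Rn n, ℂ))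
    (hψ : ∀ᶠ ξ in 𝓝 0, ψ ξ = 1) {Ω : Opens (Rn n)} {g : Lp ℂ ⊤ (volume : Measure (Rn n))}
    (hS : BoundedDerivs (Lp.toTemperedDistribution g)) {F : Rn n → ℂ}
    (hF : ContinuousOn F (Ω : Set (Rn n))) (hg : g =ᵐ[volume.restrict (Ω : Set (Rn n))] F) :
    ∃ C : ℝ, ∀ (ε : I01), ∀ x ∈ Ω,
      ‖conv (Lp.toTemperedDistribution g) (dilate (𝓕⁻ ψ) ε) x - F x‖ ≤ C * (ε : ℝ) ^ m := by
  -- One power more than required: in `(ε / 2^j)^(m+1)` the extra factor supplies the summable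
  -- `2^{-j}`.
  obtain ⟨C, hC⟩ := hS.conv_dilate_le (m + 1) _ (fourier_sub_dilate_eventually_eq_zero ψ hψ (dyadic 1 1))
  refine ⟨2 * C, fun ε x hx => ?_⟩
  have hε : 0 < (ε : ℝ) := ε.2.1
  have hC0 : 0 ≤ C := by simpa [coe_dyadic] using (norm_nonneg _).trans (hC 1 x)
  have hint : ∫ y, (𝓕⁻ ψ : 𝓢(Rn n, ℂ)) y = 1 := by rw [integral_fourierInv, hψ.self_of_nhds]
  have hlim := tendsto_conv_dilate g (𝓕⁻ ψ) hint hF hg hx (dyadic ε) (by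
    have := (tendsto_pow_atTop_nhds_zero_of_lt_one (r := (2⁻¹ : ℝ)) (by norm_num)
      (by norm_num)).const_mul (ε : ℝ)
    simpa [coe_dyadic, div_eq_mul_inv] using this)
  -- Written as `A / 2 / 2 ^ j` with `A = 2 C ε^m`, the steps sum to `A`, which is the final bound.
  have hstep : ∀ j, dist (conv (Lp.toTemperedDistribution g) (dilate (𝓕⁻ ψ) (dyadic ε j)) x)
      (conv (Lp.toTemperedDistribution g) (dilate (𝓕⁻ ψ) (dyadic ε (j + 1))) x) ≤
      2 * C * (ε : ℝ) ^ m / 2 / 2 ^ j := by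
    intro j
    rw [dilate_dyadic_succ, dist_eq_norm, ← conv_sub, ← dilate_sub]
    refine (hC _ x).trans ?_
    rw [coe_dyadic, pow_succ]
    have h1 : (ε : ℝ) / 2 ^ j ≤ ε := div_le_self hε.le (one_le_pow₀ one_le_two)
    calc C * (((ε : ℝ) / 2 ^ j) ^ m * (ε / 2 ^ j)) ≤ C * ((ε : ℝ) ^ m * (1 / 2 ^ j)) := by
          gcongr
          exact ε.2.2
      _ = 2 * C * (ε : ℝ) ^ m / 2 / 2 ^ j := by ring
  have := dist_le_of_le_geometric_two_of_tendsto₀ hstep hlim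
  have h0 : dyadic ε 0 = ε := Subtype.ext (by simp [coe_dyadic])
  rwa [h0, dist_eq_norm] at this

/-! ### Tempered distributions are determined by compactly supported test functions -/

/-- Multiplication by a smooth function that vanishes on a ball of radius `c⁻¹` and is obtained from
a fixed one by dilation makes the seminorms of a Schwartz function `O(c)`. -/
theorem seminorm_smulLeftCLM_dilate_le {w : Rn n → ℝ} (hw : w.HasTemperateGrowth)
    (hw0 : ∀ x, ‖x‖ < 1 → w x = 0) (κ : 𝓢(Rn n, ℂ)) (k l : ℕ) :
    ∃ C : ℝ, ∀ c : ℝ, 0 < c → c ≤ 1 →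
      SchwartzMap.seminorm ℝ k l (SchwartzMap.smulLeftCLM ℂ (fun x => w (c • x)) κ) ≤ C * c := by
  obtain ⟨p, A, hA, hwA⟩ := hw.norm_iteratedFDeriv_le_uniform l
  -- Of the decay of `κ`, `k` powers absorb the weight, `p` the growth of `w`, and the last one
  -- leaves `1 / (1 + ‖x‖)`.
  choose B hB hκ using fun i : ℕ => norm_iteratedFDeriv_le κ (k + p + 1) i
  refine ⟨∑ i ∈ Finset.range (l + 1), (l.choose i : ℝ) * A * B (l - i), fun c hc hc1 => ?_⟩
  have hsum : ∀ i ∈ Finset.range (l + 1), 0 ≤ (l.choose i : ℝ) * A * B (l - i) := fun i _ =>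
    mul_nonneg (by positivity) (hB _)
  have hwc : (fun x => w (c • x)).HasTemperateGrowth :=
    hw.comp ((c • ContinuousLinearMap.id ℝ (Rn n)).hasTemperateGrowth)
  refine SchwartzMap.seminorm_le_bound ℝ k l _ (mul_nonneg (Finset.sum_nonneg hsum) hc.le) fun x => ?_
  rw [SchwartzMap.smulLeftCLM_apply hwc]
  by_cases hx : ‖c • x‖ < 1
  · have e : (fun y => w (c • y) • κ y) =ᶠ[𝓝 x] fun _ => 0 := by
      have : ∀ᶠ y in 𝓝 x, ‖c • y‖ < 1 :=
        (by fun_prop : Continuous fun y : Rn n => ‖c • y‖).continuousAt.eventually (gt_mem_nhds hx)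
      filter_upwards [this] with y hy
      rw [hw0 _ hy, zero_smul]
    rw [(e.iteratedFDeriv ℝ l).eq_of_nhds]
    simp only [iteratedFDeriv_fun_zero, Pi.zero_apply, norm_zero, mul_zero]
    exact mul_nonneg (Finset.sum_nonneg hsum) hc.le
  -- Where the cutoff is not known to vanish, `1 / (1 + ‖x‖) ≤ c`; this produces the factor `c`.
  · have hx1 : 1 ≤ c * (1 + ‖x‖) := by
      rw [not_lt, norm_smul, Real.norm_of_nonneg hc.le] at hx
      nlinarith
    refine (mul_le_mul_of_nonneg_left (norm_iteratedFDeriv_smul_le hwc.1 (κ.smooth ⊤) x (n := l)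
      (by exact_mod_cast le_top)) (by positivity)).trans ?_
    rw [Finset.mul_sum, Finset.sum_mul]
    refine Finset.sum_le_sum fun i hi => ?_
    have h1 : ‖iteratedFDeriv ℝ i (fun x => w (c • x)) x‖ ≤ A * (1 + ‖x‖) ^ p := by
      rw [iteratedFDeriv_comp_const_smul c (hw.1.of_le (by exact_mod_cast le_top)), norm_smul,
        norm_pow, Real.norm_of_nonneg hc.le]
      refine (mul_le_of_le_one_left (norm_nonneg _) (pow_le_one₀ hc.le hc1)).trans
        ((hwA i (Finset.mem_range_succ_iff.1 hi) _).trans ?_)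
      gcongr
      rw [norm_smul, Real.norm_of_nonneg hc.le]
      exact mul_le_of_le_one_left (norm_nonneg _) hc1
    have hBi := hB (l - i)
    calc ‖x‖ ^ k * ((l.choose i : ℝ) * ‖iteratedFDeriv ℝ i (fun x => w (c • x)) x‖ *
          ‖iteratedFDeriv ℝ (l - i) κ x‖)
        ≤ (1 + ‖x‖) ^ k * ((l.choose i : ℝ) * (A * (1 + ‖x‖) ^ p) *
          (B (l - i) / (1 + ‖x‖) ^ (k + p + 1))) := by
          gcongr
          · linarith
          · exact hκ _ x
      _ = (l.choose i : ℝ) * A * B (l - i) * (1 / (1 + ‖x‖)) := by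
          rw [pow_succ, pow_add]
          field_simp
      _ ≤ (l.choose i : ℝ) * A * B (l - i) * c := by
          gcongr
          rwa [div_le_iff₀ (by positivity)]

/-- Compactly supported functions are dense in the Schwartz space. -/
theorem exists_tendsto_hasCompactSupport (κ : 𝓢(Rn n, ℂ)) :
    ∃ u : ℕ → 𝓢(Rn n, ℂ), (∀ j, HasCompactSupport (u j)) ∧ Filter.Tendsto u .atTop (𝓝 κ) := by
  let b : ContDiffBump (0 : Rn n) := ⟨1, 2, one_pos, one_lt_two⟩
  have hb : (b : Rn n → ℝ).HasTemperateGrowth := b.hasCompactSupport.hasTemperateGrowth b.contDiff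
  have hw : (fun x => 1 - b x).HasTemperateGrowth := (Function.HasTemperateGrowth.const 1).sub hb
  let c : ℕ → ℝ := fun j => 1 / ((j : ℝ) + 1)
  have hc : ∀ j, 0 < c j := fun j => by positivity
  have hc1 : ∀ j, c j ≤ 1 := fun j => by
    simp only [c]
    rw [div_le_one (by positivity)]
    linarith [(Nat.cast_nonneg j : (0 : ℝ) ≤ j)]
  have hbc : ∀ j, (fun x => b (c j • x)).HasTemperateGrowth := fun j =>
    hb.comp ((c j • ContinuousLinearMap.id ℝ (Rn n)).hasTemperateGrowth)
  have hwc : ∀ j, (fun x => 1 - b (c j • x)).HasTemperateGrowth := fun j =>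
    (Function.HasTemperateGrowth.const 1).sub (hbc j)
  refine ⟨fun j => SchwartzMap.smulLeftCLM ℂ (fun x => b (c j • x)) κ, fun j => ?_, ?_⟩
  · rw [SchwartzMap.smulLeftCLM_apply (hbc j)]
    exact (b.hasCompactSupport.comp_smul (hc j).ne').smul_right
  · rw [(schwartz_withSeminorms ℝ (Rn n) ℂ).tendsto_nhds]
    rintro ⟨k, l⟩ e he
    obtain ⟨C, hC⟩ := seminorm_smulLeftCLM_dilate_le hw (fun x hx => by
      rw [b.one_of_mem_closedBall (by simpa using hx.le), sub_self]) κ k l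
    have hlim : Filter.Tendsto (fun j => C * c j) .atTop (𝓝 0) := by
      simpa [c] using (tendsto_one_div_add_atTop_nhds_zero_nat (𝕜 := ℝ)).const_mul C
    filter_upwards [hlim.eventually (gt_mem_nhds he)] with j hj
    rw [← map_neg_eq_map]
    have e : -(SchwartzMap.smulLeftCLM ℂ (fun x => b (c j • x)) κ - κ) =
        SchwartzMap.smulLeftCLM ℂ (fun x => 1 - b (c j • x)) κ := by
      ext x
      rw [SchwartzMap.smulLeftCLM_apply_apply (hwc j), neg_sub, sub_apply,
        SchwartzMap.smulLeftCLM_apply_apply (hbc j), sub_smul, one_smul]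
    rw [e]
    exact (hC _ (hc j) (hc1 j)).trans_lt hj

/-- Restriction only sees real test functions. Splitting into real and imaginary parts reaches all
compactly supported Schwartz functions, and density with continuity of `T` does the rest. -/
theorem eq_zero_of_restrict_top_eq_zero (T : 𝓢'(Rn n, ℂ)) (hT : restrict ⊤ T = 0) : T = 0 := by
  have hreal : ∀ v : Rn n → ℝ, ContDiff ℝ ∞ v → HasCompactSupport v → ∀ κ : 𝓢(Rn n, ℂ),
      (∀ x, κ x = v x) → T κ = 0 := by
    intro v hv hvc κ hκ
    let χ : 𝓓((⊤ : Opens (Rn n)), ℝ) := ⟨v, hv, hvc, Set.subset_univ _⟩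
    have := DFunLike.congr_fun hT χ
    have e : testToSchwartz χ = κ := by
      ext x
      rw [hκ]
      rfl
    rw [← e]
    exact this
  have hcpt : ∀ κ : 𝓢(Rn n, ℂ), HasCompactSupport κ → T κ = 0 := by
    intro κ hκ
    let re : 𝓢(Rn n, ℂ) := SchwartzMap.postcompCLM (𝕜 := ℝ) (Complex.ofRealCLM ∘L Complex.reCLM) κ
    let im : 𝓢(Rn n, ℂ) := SchwartzMap.postcompCLM (𝕜 := ℝ) (Complex.ofRealCLM ∘L Complex.imCLM) κ
    have e : κ = re + Complex.I • im := by
      ext x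
      have : (κ x).re + Complex.I * (κ x).im = κ x := by rw [mul_comm, Complex.re_add_im]
      exact this.symm
    rw [e, map_add, map_smul,
      hreal (fun x => (κ x).re) (Complex.reCLM.contDiff.comp (κ.smooth ⊤))
        (hκ.comp_left (g := Complex.re) rfl) re (fun x => rfl),
      hreal (fun x => (κ x).im) (Complex.imCLM.contDiff.comp (κ.smooth ⊤))
        (hκ.comp_left (g := Complex.im) rfl) im (fun x => rfl), smul_zero, add_zero]
  ext κ
  obtain ⟨u, hu, hlim⟩ := exists_tendsto_hasCompactSupport κ
  have h1 := ((map_continuous T).tendsto κ).comp hlim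
  have h2 : T ∘ u = fun _ => 0 := funext fun j => hcpt _ (hu j)
  rw [h2] at h1
  exact tendsto_nhds_unique h1 tendsto_const_nhds

/-! ### Distributions given by functions, and their derivatives -/

theorem ofFun_apply {U : Opens (Rn n)} {g : Rn n → ℂ} (hg : LocallyIntegrableOn g (U : Set (Rn n)))
    (χ : 𝓓(U, ℝ)) : ofFun U g χ = ∫ x, χ x • g x := by
  exact TestFunction.integralAgainstBilinCLM_eq_integral hg

theorem restrict_toTemperedDistribution (U : Opens (Rn n))
    (g : Lp ℂ ⊤ (volume : Measure (Rn n))) :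
    restrict U (Lp.toTemperedDistribution g) = ofFun U g := by
  ext χ
  rw [ofFun_apply (((Lp.memLp g).locallyIntegrable le_top).locallyIntegrableOn _)]
  change Lp.toTemperedDistribution g (testToSchwartz χ) = _
  rw [Lp.toTemperedDistribution_apply]
  rfl

theorem restrict_sub (U : Opens (Rn n)) (S T : 𝓢'(Rn n, ℂ)) :
    restrict U (S - T) = restrict U S - restrict U T := rfl

theorem ofFun_congr_ae (U : Opens (Rn n)) {g g' : Rn n → ℂ} (h : g =ᵐ[volume] g') (hg : MemLp g ⊤) :
    ofFun U g = ofFun U g' := by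
  ext χ
  rw [ofFun_apply ((hg.locallyIntegrable le_top).locallyIntegrableOn _),
    ofFun_apply (((hg.ae_eq h).locallyIntegrable le_top).locallyIntegrableOn _)]
  refine integral_congr_ae ?_
  filter_upwards [h] with x hx
  rw [hx]

/-- Finiteness gives a bounded function representing `T` on test functions only; the density result
upgrades this to equality of tempered distributions. -/
theorem exists_eq_toTemperedDistribution {T : 𝓢'(Rn n, ℂ)} (hT : lpNorm ⊤ (restrict ⊤ T) < ⊤) :
    ∃ g : Lp ℂ ⊤ (volume : Measure (Rn n)), T = Lp.toTemperedDistribution g := by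
  simp only [lpNorm, iInf_lt_iff] at hT
  obtain ⟨g, hg, hTg, -⟩ := hT
  have hg' : MemLp g ⊤ (volume : Measure (Rn n)) := by simpa using hg
  refine ⟨hg'.toLp g, sub_eq_zero.1 (eq_zero_of_restrict_top_eq_zero _ ?_)⟩
  rw [restrict_sub, restrict_toTemperedDistribution, hTg, sub_eq_zero]
  exact ofFun_congr_ae _ hg'.coeFn_toLp.symm hg'

theorem testToSchwartz_lineDeriv {U : Opens (Rn n)} (v : Rn n) (χ : 𝓓(U, ℝ)) :
    testToSchwartz (-∂_{v} χ : 𝓓(U, ℝ)) = -(∂_{v} (testToSchwartz χ) : 𝓢(Rn n, ℂ)) := by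
  ext x
  have h : HasFDerivAt (testToSchwartz χ) (Complex.ofRealCLM ∘L fderiv ℝ χ x) x :=
    Complex.ofRealCLM.hasFDerivAt.comp x
      ((χ.contDiff.differentiable (by simp)) x).hasFDerivAt
  rw [neg_apply, SchwartzMap.lineDerivOp_apply_eq_fderiv, h.fderiv, testToSchwartz_apply, neg_apply,
    TestFunction.lineDerivOp_eq_lineDerivCLM ℝ, TestFunction.lineDerivCLM_apply_of_le le_top,
    ((χ.contDiff.differentiable (by simp)) x).lineDeriv_eq_fderiv]
  simp

theorem lineDeriv_restrict (U : Opens (Rn n)) (v : Rn n) (T : 𝓢'(Rn n, ℂ)) :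
    ∂_{v} (restrict U T) = restrict U (∂_{v} T) := by
  ext χ
  rw [Distribution.lineDerivOp_apply_apply]
  change T (testToSchwartz _) = (∂_{v} T) (testToSchwartz χ)
  rw [testToSchwartz_lineDeriv, TemperedDistribution.lineDerivOp_apply_apply]

theorem iteratedLineDeriv_restrict (U : Opens (Rn n)) {j : ℕ} (m : Fin j → Rn n) (T : 𝓢'(Rn n, ℂ)) :
    ∂^{m} (restrict U T) = restrict U (∂^{m} T) := by
  induction j with
  | zero => rfl
  | succ j ih =>
    rw [LineDeriv.iteratedLineDerivOp_succ_left, LineDeriv.iteratedLineDerivOp_succ_left, ih,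
      lineDeriv_restrict]

/-- Integration by parts, with no boundary term because the support of the test function is a
compact subset of `U`. Nothing is required of `f` outside `U`. -/
theorem lineDeriv_ofFun {U : Opens (Rn n)} {f f' : Rn n → ℂ} {v : Rn n}
    (hf : ContinuousOn f (U : Set (Rn n))) (hf' : ContinuousOn f' (U : Set (Rn n)))
    (h : ∀ x ∈ U, HasLineDerivAt ℝ f (f' x) x v) : ∂_{v} (ofFun U f) = ofFun U f' := by
  have hi : LocallyIntegrableOn f (U : Set (Rn n)) :=
    hf.locallyIntegrableOn U.isOpen.measurableSet
  have hi' : LocallyIntegrableOn f' (U : Set (Rn n)) :=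
    hf'.locallyIntegrableOn U.isOpen.measurableSet
  ext χ
  rw [Distribution.lineDerivOp_apply_apply, map_neg, ofFun_apply hi, ofFun_apply hi']
  let B : ℂ →L[ℝ] ℝ →L[ℝ] ℂ := (ContinuousLinearMap.lsmul ℝ ℝ : ℝ →L[ℝ] ℂ →L[ℝ] ℂ).flip
  have hχ : ∀ x, HasLineDerivAt ℝ χ ((∂_{v} χ : 𝓓(U, ℝ)) x) x v := fun x => by
    rw [TestFunction.lineDerivOp_eq_lineDerivCLM ℝ, TestFunction.lineDerivCLM_apply_of_le le_top]
    exact (((χ.contDiff.differentiable (by simp)) x).lineDifferentiableAt).hasLineDerivAt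
  have key := integral_bilinear_hasLineDerivAt_right_eq_neg_left_of_integrable
    (μ := (volume : Measure (Rn n))) (B := B) (f := f) (f' := f') (g := χ)
    (g' := (∂_{v} χ : 𝓓(U, ℝ))) (v := v)
    (χ.integrable_bilin (ContinuousLinearMap.lsmul ℝ ℝ) hi')
    ((∂_{v} χ : 𝓓(U, ℝ)).integrable_bilin (ContinuousLinearMap.lsmul ℝ ℝ) hi)
    (χ.integrable_bilin (ContinuousLinearMap.lsmul ℝ ℝ) hi)
    (fun x hx => h x (χ.tsupport_subset hx)) (fun x _ => hχ x)
  change -(∫ x, B (f x) ((∂_{v} χ : 𝓓(U, ℝ)) x)) = ∫ x, B (f' x) (χ x)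
  rw [key, neg_neg]

theorem continuousOn_iteratedFDeriv_apply {U : Opens (Rn n)} {f : Rn n → ℂ}
    (hf : ContDiffOn ℝ ∞ f (U : Set (Rn n))) {j : ℕ} (m : Fin j → Rn n) :
    ContinuousOn (fun x => iteratedFDeriv ℝ j f x m) (U : Set (Rn n)) := by
  have h := (hf.continuousOn_iteratedFDerivWithin (m := j) (by exact_mod_cast le_top)
    U.isOpen.uniqueDiffOn).congr fun x hx => (iteratedFDerivWithin_of_isOpen j U.isOpen hx).symm
  exact (continuous_eval_const m).comp_continuousOn h

theorem iteratedLineDeriv_ofFun {U : Opens (Rn n)} {f : Rn n → ℂ}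
    (hf : ContDiffOn ℝ ∞ f (U : Set (Rn n))) {j : ℕ} (m : Fin j → Rn n) :
    ∂^{m} (ofFun U f) = ofFun U fun x => iteratedFDeriv ℝ j f x m := by
  induction j with
  | zero => rfl
  | succ j ih =>
    rw [LineDeriv.iteratedLineDerivOp_succ_left, ih]
    refine lineDeriv_ofFun (continuousOn_iteratedFDeriv_apply hf _)
      (continuousOn_iteratedFDeriv_apply hf _) fun x hx => ?_
    have hd : DifferentiableAt ℝ (iteratedFDeriv ℝ j f) x :=
      (hf.contDiffAt (U.isOpen.mem_nhds hx)).differentiableAt_iteratedFDeriv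
        (by exact_mod_cast ENat.natCast_lt_top j)
    have := ((ContinuousMultilinearMap.apply ℝ (fun _ : Fin j => Rn n) ℂ
      (Fin.tail m)).hasFDerivAt.comp x hd.hasFDerivAt).hasLineDerivAt (m 0)
    exact this

/-- The fundamental lemma of the calculus of variations, applied to `g - F` on `U`. -/
theorem ae_eq_of_restrict_eq_ofFun {U : Opens (Rn n)} {g : Lp ℂ ⊤ (volume : Measure (Rn n))}
    {F : Rn n → ℂ} (hF : ContinuousOn F (U : Set (Rn n)))
    (h : restrict U (Lp.toTemperedDistribution g) = ofFun U F) :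
    g =ᵐ[volume.restrict (U : Set (Rn n))] F := by
  have hg : LocallyIntegrableOn g (U : Set (Rn n)) :=
    ((Lp.memLp g).locallyIntegrable le_top).locallyIntegrableOn _
  have hFi : LocallyIntegrableOn F (U : Set (Rn n)) :=
    hF.locallyIntegrableOn U.isOpen.measurableSet
  rw [restrict_toTemperedDistribution] at h
  refine (ae_restrict_iff' U.isOpen.measurableSet).2 ?_
  have := U.isOpen.ae_eq_zero_of_integral_contDiff_smul_eq_zero (hg.sub hFi)
    fun v hv hvc hvU => ?_
  · filter_upwards [this] with x hx hxU
    exact sub_eq_zero.1 (hx hxU)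
  · let χ : 𝓓(U, ℝ) := ⟨v, hv, hvc, hvU⟩
    have h1 := DFunLike.congr_fun h χ
    rw [ofFun_apply hg, ofFun_apply hFi] at h1
    simp only [Pi.sub_apply, smul_sub]
    exact (integral_sub (χ.integrable_bilin (ContinuousLinearMap.lsmul ℝ ℝ) hg)
      (χ.integrable_bilin (ContinuousLinearMap.lsmul ℝ ℝ) hFi)).trans (sub_eq_zero.2 h1)

/-! ### From partial derivatives to null nets -/

/-- Expand each argument in the standard basis; coordinates are bounded by the norm. This reduces
the total derivatives in `mu` to partial derivatives. -/
theorem norm_le_sum_norm_single {j : ℕ}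
    (M : ContinuousMultilinearMap ℝ (fun _ : Fin j => Rn n) ℂ) :
    ‖M‖ ≤ ∑ i : Fin j → Fin n, ‖M fun s => EuclideanSpace.single (i s) (1 : ℝ)‖ := by
  refine M.opNorm_le_bound (Finset.sum_nonneg fun _ _ => norm_nonneg _) fun m => ?_
  have hm : m = fun s => ∑ i, m s i • EuclideanSpace.single i (1 : ℝ) := by
    funext s
    conv_lhs => rw [← (EuclideanSpace.basisFun (Fin n) ℝ).sum_repr (m s)]
    simp
  conv_lhs => rw [hm]
  rw [M.map_sum, Finset.sum_mul]
  refine norm_sum_le_of_le _ fun i _ => ?_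
  rw [M.map_smul_univ, norm_smul, mul_comm, norm_prod]
  gcongr with s
  exact PiLp.norm_apply_le (m s) (i s)

/-- Derivatives of the mollification fall on the distribution, so each one is the mollification of
another distribution and the order-zero estimate covers it. -/
theorem iteratedFDeriv_conv_apply (T : 𝓢'(Rn n, ℂ)) (φ : 𝓢(Rn n, ℂ)) {j : ℕ} (m : Fin j → Rn n)
    (x : Rn n) : iteratedFDeriv ℝ j (conv T φ) x m = conv (∂^{m} T) φ x := by
  induction j generalizing x with
  | zero => simp
  | succ j ih =>
    have hd : DifferentiableAt ℝ (iteratedFDeriv ℝ j (conv T φ)) x :=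
      (contDiff_conv T φ).contDiffAt.differentiableAt_iteratedFDeriv
        (by exact_mod_cast ENat.natCast_lt_top j)
    have h1 := (ContinuousMultilinearMap.apply ℝ (fun _ : Fin j => Rn n) ℂ
      (Fin.tail m)).hasFDerivAt.comp x hd.hasFDerivAt
    have h2 : (ContinuousMultilinearMap.apply ℝ (fun _ : Fin j => Rn n) ℂ (Fin.tail m)) ∘
        iteratedFDeriv ℝ j (conv T φ) = conv (∂^{Fin.tail m} T) φ := funext fun y => ih _ y
    rw [h2] at h1
    have h3 := DFunLike.congr_fun (h1.unique (hasFDerivAt_conv _ φ x)) (m 0)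
    rw [convDeriv_apply, conv_lineDeriv, ← LineDeriv.iteratedLineDerivOp_succ_left] at h3
    exact h3

/-- On `Ω` the distributional derivatives are the classical ones, and those of order `j` are bounded
by `mu j f`, finite because `Ω` is bounded. -/
theorem memSobolev_ofFun {Ω : Opens (Rn n)} (hΩ : Bornology.IsBounded (Ω : Set (Rn n)))
    (f : SmoothClosure Ω) (k : ℕ∞) : MemSobolev k ⊤ (ofFun Ω (zeroExt f.1)) := by
  refine fun l _ => ENNReal.sum_lt_top.2 fun j _ => ENNReal.sum_lt_top.2 fun i _ => ?_
  have hf := f.2.mono subset_closure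
  rw [iteratedLineDeriv_ofFun hf]
  set m : Fin j → Rn n := fun s => EuclideanSpace.single (i s) (1 : ℝ)
  have hb : MemLp (fun x => iteratedFDeriv ℝ j (zeroExt f.1) x m) ⊤
      (volume.restrict (Ω : Set (Rn n))) := by
    refine memLp_top_of_bound ((continuousOn_iteratedFDeriv_apply hf m).aestronglyMeasurable
      Ω.isOpen.measurableSet) ((mu j f).toReal * ∏ s, ‖m s‖) ?_
    refine (ae_restrict_iff' Ω.isOpen.measurableSet).2 (Filter.Eventually.of_forall fun x hx => ?_)
    refine (ContinuousMultilinearMap.le_opNorm _ _).trans ?_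
    gcongr
    rw [← toReal_enorm]
    exact ENNReal.toReal_mono (mu_lt_top hΩ j f).ne (enorm_le_mu f le_rfl hx)
  exact lt_of_le_of_lt (iInf_le_of_le _ (iInf_le_of_le hb (iInf_le _ rfl))) hb.2

/-- The bound for `E` at `p = ∞` makes the Sobolev norm of the extension finite at each order, hence
each of its summands, one per partial derivative. -/
theorem IsTotalExtension.boundedDerivs {Ω Ω' : Opens (Rn n)} {E : DistSpace Ω Ω' →ₗ[ℂ] 𝓢'(Rn n, ℂ)}
    (hE : IsTotalExtension E) {u : DistSpace Ω Ω'} (hu : MemSobolev ⊤ ⊤ (u : 𝓓'(Ω, ℂ))) :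
    BoundedDerivs (E u) := by
  intro j i
  obtain ⟨C, hC⟩ := hE.sobolev_bound j ⊤ le_top
  have h := (hC u fun m _ => hu m le_top).trans_lt (ENNReal.mul_lt_top ENNReal.coe_lt_top
    (hu j le_top))
  have h1 := ENNReal.sum_lt_top.1 h j (Finset.self_mem_range_succ j)
  have h2 := ENNReal.sum_lt_top.1 h1 i (Finset.mem_univ i)
  rw [iteratedLineDeriv_restrict] at h2
  exact exists_eq_toTemperedDistribution h2

theorem BoundedDerivs.iteratedLineDeriv {S : 𝓢'(Rn n, ℂ)} (hS : BoundedDerivs S) {j : ℕ}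
    (i : Fin j → Fin n) :
    BoundedDerivs (∂^{fun s => EuclideanSpace.single (i s) (1 : ℝ)} S) := by
  induction j with
  | zero => exact hS
  | succ j ih =>
    rw [LineDeriv.iteratedLineDerivOp_succ_left]
    exact (ih (Fin.tail i)).lineDeriv (i 0)

/-- The nets `T * φ_ε` and `f` differ by a null net on `Ω̄` if all derivatives of `T` are bounded and
`T` coincides with `f` on `Ω`. -/
theorem BoundedDerivs.isBigOPow_convNet_sub {Ω : Opens (Rn n)} {T : 𝓢'(Rn n, ℂ)}
    (hT : BoundedDerivs T) (f : SmoothClosure Ω) (hTf : restrict Ω T = ofFun Ω (zeroExt f.1))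
    (ψ : 𝓢(Rn n, ℂ)) (hψ : ∀ᶠ ξ in 𝓝 0, ψ ξ = 1) (k : ℕ) (a : ℝ) :
    IsBigOPow (fun ε => mu k (convNet Ω (𝓕⁻ ψ) T ε - f)) a := by
  -- Since `ε ≤ 1`, decay of a larger natural order implies decay of order `a`.
  obtain ⟨N, hN⟩ := exists_nat_ge a
  refine IsBigOPow.of_le ?_ hN
  have hf := f.2.mono subset_closure
  have main : ∀ (j : ℕ) (i : Fin j → Fin n), ∃ C : ℝ, ∀ (ε : I01), ∀ x ∈ Ω,
      ‖conv (∂^{fun s => EuclideanSpace.single (i s) (1 : ℝ)} T) (dilate (𝓕⁻ ψ) ε) x -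
        iteratedFDeriv ℝ j (zeroExt f.1) x fun s => EuclideanSpace.single (i s) (1 : ℝ)‖ ≤
        C * (ε : ℝ) ^ N := by
    intro j i
    obtain ⟨g, hg⟩ := hT j i
    have hb := hT.iteratedLineDeriv i
    rw [hg] at hb ⊢
    refine hb.norm_conv_dilate_sub_le N ψ hψ (continuousOn_iteratedFDeriv_apply hf _)
      (ae_eq_of_restrict_eq_ofFun (continuousOn_iteratedFDeriv_apply hf _) ?_)
    rw [← hg, ← iteratedLineDeriv_restrict, hTf, iteratedLineDeriv_ofFun hf]
  choose C hC using main
  -- Absolute values, because nothing gives the sign of the constants `C j i` (for empty `Ω` they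
  -- are arbitrary).
  let D : ℕ → ℝ := fun j => ∑ i : Fin j → Fin n, |C j i|
  have hD : ∀ j, 0 ≤ D j := fun j => Finset.sum_nonneg fun i _ => abs_nonneg _
  refine ⟨(∑ j ∈ Finset.range (k + 1), D j).toNNReal, 1, one_pos, fun ε _ =>
    mu_le fun j hj x hx => ?_⟩
  have hε : 0 < (ε : ℝ) := ε.2.1
  have e : zeroExt (convNet Ω (𝓕⁻ ψ) T ε - f).1 =ᶠ[𝓝 x]
      conv T (dilate (𝓕⁻ ψ) ε) - zeroExt f.1 :=
    zeroExt_eventuallyEq (g := conv T (dilate (𝓕⁻ ψ) ε) - zeroExt f.1)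
      (fun y => by rw [Pi.sub_apply, zeroExt_apply]; rfl) hx
  rw [(e.iteratedFDeriv ℝ j).eq_of_nhds, ← ofReal_norm, Real.rpow_natCast]
  change _ ≤ ENNReal.ofReal (∑ j ∈ Finset.range (k + 1), D j) * _
  rw [← ENNReal.ofReal_mul (Finset.sum_nonneg fun j _ => hD j)]
  refine ENNReal.ofReal_le_ofReal ?_
  calc _ ≤ D j * (ε : ℝ) ^ N := by
        refine (norm_le_sum_norm_single _).trans ?_
        rw [Finset.sum_mul]
        refine Finset.sum_le_sum fun i _ => ?_
        rw [iteratedFDeriv_sub_apply ((contDiff_conv T _).contDiffAt.of_le (by exact_mod_cast le_top))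
          ((contDiffAt_zeroExt f hx).of_le (by exact_mod_cast le_top)), sub_apply,
          iteratedFDeriv_conv_apply]
        refine (hC j i ε x hx).trans ?_
        gcongr
        exact le_abs_self _
    _ ≤ _ := by
        gcongr
        exact Finset.single_le_sum (fun j _ => hD j) (Finset.mem_range_succ_iff.2 hj)

theorem embedding_ofSmooth {Ω Ω' : Opens (Rn n)} (hΩ : Bornology.IsBounded (Ω : Set (Rn n)))
    {E : DistSpace Ω Ω' →ₗ[ℂ] 𝓢'(Rn n, ℂ)} (hE : IsTotalExtension E) (ψ : 𝓢(Rn n, ℂ))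
    (hψ : ∀ᶠ ξ in 𝓝 0, ψ ξ = 1) (f : SmoothClosure Ω) :
    embedding hΩ E (𝓕⁻ ψ) (ofSmooth Ω' hΩ f) = sigma hΩ f := by
  have hb : BoundedDerivs (E (ofSmooth Ω' hΩ f)) :=
    hE.boundedDerivs (memSobolev_ofFun hΩ f ⊤)
  exact Ideal.Quotient.eq.2 fun k a =>
    hb.isBigOPow_convNet_sub f (hE.restrict_eq _) ψ hψ k a

end Colombeau

end

theorem proposition3p8 {n : ℕ} (Ω Ω' : Opens (Colombeau.Rn n))
    (hΩ : Bornology.IsBounded (Ω : Set (Colombeau.Rn n)))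
    (hsmooth : Colombeau.IsSmoothDomain Ω)
    (hcompact : IsCompact (closure (Ω' : Set (Colombeau.Rn n))))
    (hsub : closure (Ω' : Set (Colombeau.Rn n)) ⊆ Ω)
    (E : Colombeau.DistSpace Ω Ω' →ₗ[ℂ] 𝓢'(Colombeau.Rn n, ℂ))
    (hE : Colombeau.IsTotalExtension E)
    (ψ : 𝓢(Colombeau.Rn n, ℂ)) (hψ : ∀ᶠ ξ in 𝓝 (0 : Colombeau.Rn n), ψ ξ = 1) :
    (∀ f : Colombeau.SmoothClosure Ω,
      Colombeau.embedding hΩ E (𝓕⁻ ψ) (Colombeau.ofSmooth Ω' hΩ f) = Colombeau.sigma hΩ f) ∧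
    (∀ f g : Colombeau.SmoothClosure Ω,
      Colombeau.embedding hΩ E (𝓕⁻ ψ) (Colombeau.ofSmooth Ω' hΩ (f * g)) =
        Colombeau.embedding hΩ E (𝓕⁻ ψ) (Colombeau.ofSmooth Ω' hΩ f) *
          Colombeau.embedding hΩ E (𝓕⁻ ψ) (Colombeau.ofSmooth Ω' hΩ g)) := by
  have h := Colombeau.embedding_ofSmooth hΩ hE ψ hψ
  exact ⟨h, fun f g => by rw [h, h, h, map_mul]⟩
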